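/- Let $\mathbb N=\{1,2,3,\dots\}$. For $j\in\mathbb N$ let $S_j(x)=\frac{1}{2^{j+1}}x+1-\frac{1}{2^{j-1}}$ $(x\in\mathbb R)$, and let $p_1=\frac14$, $p_j=\frac{3}{2^{j+1}}$ for $j\ge 2$. Let $P$ be the unique Borel probability measure on $\mathbb R$ with $P=\sum_{j=1}^\infty p_j\,P\circ S_j^{-1}$, and let $X$ be a random variable with distribution $P$. For a finite word $\omega=\omega_1\cdots\omega_k$ over $\mathbb N$ (possibly empty) put $S_\omega=S_{\omega_1}\circ\cdots\circ S_{\omega_k}$ (the identity if $\omega$ is empty), $J_\omega=S_\omega([0,1])$ and $$a(\omega)=E(X\mid X\in J_\omega)=\frac{1}{P(J_\omega)}\int_{J_\omega}x\,dP .$$ For a nonempty word $\omega=\omega_1\cdots\omega_k$ write $\omega^-=\omega_1\cdots\omega_{k-1}$ and put $J_{(\omega,\infty)}=\bigcup_{j=1}^\infty J_{\omega^-(\omega_k+j)}$ and $$a(\omega,\infty)=E(X\mid X\in J_{(\omega,\infty)})=\frac{1}{P(J_{(\omega,\infty)})}\int_{J_{(\omega,\infty)}}x\,dP .$$ For $n\ge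 1$, an optimal set of $n$-means for $P$ is a set $\alpha\subset\mathbb R$ with $1\le\operatorname{card}(\alpha)\le n$ such that $\int\min_{a\in\alpha}|x-a|^2\,dP(x)$ equals the infimum of $\int\min_{b\in\beta}|x-b|^2\,dP(x)$ over all $\beta\subset\mathbb R$ with $1\le\operatorname{card}(\beta)\le n$. Let $n\ge 2$, let $\alpha_n$ be an optimal set of $n$-means for $P$, and let $c\in\alpha_n$. Then either $c=a(\omega)=S_\omega(\tfrac47)$ for some finite word $\omega$ over $\mathbb N$, or $c=a(\omega,\infty)$ for some nonempty finite word $\omega$ over $\mathbb N$. -/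

import Mathlib

open MeasureTheory Filter Topology
open scoped ENNReal

namespace NMeans

/-! ### The infinite iterated function system -/

/-- The probability vector `(p_j)`: `p_1 = 1/4` and `p_j = 3 / 2 ^ (j + 1)` for `j ≥ 2`. -/
noncomputable def p (j : ℕ+) : ℝ := if j = 1 then 1 / 4 else 3 / 2 ^ ((j : ℕ) + 1)

/-- The similitude `S_j x = x / 2 ^ (j + 1) + 1 - 1 / 2 ^ (j - 1)` (here `j ≥ 1`). -/
noncomputable def S (j : ℕ+) (x : ℝ) : ℝ :=
  1 / 2 ^ ((j : ℕ) + 1) * x + 1 - 1 / 2 ^ ((j : ℕ) - 1)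

/-- `P` is a Borel probability measure on `ℝ` with `P = ∑_j p_j P ∘ S_j⁻¹`. -/
structure IsInvariant (P : Measure ℝ) : Prop where
  isProbabilityMeasure : IsProbabilityMeasure P
  eq_sum : P = Measure.sum fun j : ℕ+ => ENNReal.ofReal (p j) • P.map (S j)

/-! ### Existence and uniqueness of the invariant measure -/

section Coding

set_option linter.unusedSectionVars false

variable {ι : Type*} [MeasurableSpace ι] [DiscreteMeasurableSpace ι] [Countable ι]

/-- Prefix a digit to a sequence of digits. -/
def cons (z : ι × (ℕ → ι)) : ℕ → ι
  | 0 => z.1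
  | n + 1 => z.2 n

theorem measurable_cons : Measurable (cons : ι × (ℕ → ι) → ℕ → ι) := by
  refine measurable_pi_lambda _ fun n => ?_
  cases n with
  | zero => exact measurable_fst
  | succ n => exact (measurable_pi_apply n).comp measurable_snd

theorem map_cons (ν : Measure ι) [IsProbabilityMeasure ν] :
    (ν.prod (Measure.infinitePi fun _ : ℕ => ν)).map cons = Measure.infinitePi fun _ : ℕ => ν := by
  classical
  refine Measure.eq_infinitePi _ fun s t ht => ?_
  obtain ⟨N, hN⟩ : ∃ N, s ⊆ Finset.range (N + 1) :=
    ⟨s.sup id, fun i hi => by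
      have := Finset.le_sup (f := id) hi
      simp only [id] at this
      simp; omega⟩
  let t' : ℕ → Set ι := fun i => if i ∈ s then t i else Set.univ
  have ht' : ∀ i, MeasurableSet (t' i) := fun i => MeasurableSet.of_discrete
  have hset : (Set.pi (s : Set ℕ) t) = Set.pi (Finset.range (N + 1) : Set ℕ) t' := by
    ext x
    simp only [Set.mem_pi, Finset.mem_coe, t']
    constructor
    · intro h i _
      by_cases hi : i ∈ s
      · simpa [hi] using h i hi
      · simp [hi]
    · intro h i hi
      simpa [hi] using h i (hN hi)
  have hprod : ∏ i ∈ s, ν (t i) = ∏ i ∈ Finset.range (N + 1), ν (t' i) := by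
    rw [← Finset.prod_subset hN]
    · exact Finset.prod_congr rfl fun i hi => by simp [t', hi]
    · intro i _ hi
      simp [t', hi]
  have hpre : cons ⁻¹' (Set.pi (Finset.range (N + 1) : Set ℕ) t') =
      t' 0 ×ˢ Set.pi (Finset.range N : Set ℕ) (fun i => t' (i + 1)) := by
    ext z
    simp only [Set.mem_preimage, Set.mem_pi, Finset.mem_coe, Finset.mem_range, Set.mem_prod]
    constructor
    · intro h
      exact ⟨h 0 (by omega), fun i hi => h (i + 1) (by omega)⟩
    · rintro ⟨h0, h⟩ i hi
      cases i with
      | zero => exact h0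
      | succ i => exact h i (by omega)
  rw [hset, hprod, Measure.map_apply measurable_cons
    (MeasurableSet.pi (Finset.countable_toSet _) fun i _ => ht' i), hpre, Measure.prod_prod,
    Measure.infinitePi_pi _ (fun i _ => ht' _), Finset.prod_range_succ', mul_comm]

/-- The `n`-th term of the coding series. -/
noncomputable def codeTerm (s b : ι → ℝ) (x : ℕ → ι) (n : ℕ) : ℝ :=
  (∏ i ∈ Finset.range n, s (x i)) * b (x n)

/-- The coding map of the affine maps `y ↦ s j * y + b j`. -/
noncomputable def code (s b : ι → ℝ) (x : ℕ → ι) : ℝ := ∑' n, codeTerm s b x n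

theorem summable_codeTerm {s b : ι → ℝ} (hs : ∀ j, |s j| ≤ 1 / 2) (hb : ∀ j, |b j| ≤ 1)
    (x : ℕ → ι) : Summable (codeTerm s b x) := by
  refine Summable.of_norm_bounded
    (summable_geometric_of_lt_one (r := (1 / 2 : ℝ)) (by norm_num) (by norm_num)) fun n => ?_
  rw [codeTerm, Real.norm_eq_abs, abs_mul, Finset.abs_prod]
  have h1 : ∏ i ∈ Finset.range n, |s (x i)| ≤ (1 / 2 : ℝ) ^ n := by
    refine (Finset.prod_le_prod (fun i _ => abs_nonneg _) (fun i _ => hs (x i))).trans ?_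
    simp
  calc _ ≤ (1 / 2 : ℝ) ^ n * 1 :=
        mul_le_mul h1 (hb _) (abs_nonneg _) (by positivity)
    _ = _ := mul_one _

theorem measurable_code {s b : ι → ℝ} (hs : ∀ j, |s j| ≤ 1 / 2) (hb : ∀ j, |b j| ≤ 1) :
    Measurable (code s b) := by
  refine measurable_of_tendsto_metrizable
    (f := fun N x => ∑ n ∈ Finset.range N, codeTerm s b x n) (fun N => ?_) ?_
  · refine Finset.measurable_sum _ fun n _ => ?_
    refine Measurable.mul (Finset.measurable_prod _ fun i _ => ?_) ?_
    · exact (Measurable.of_discrete (f := s)).comp (measurable_pi_apply i)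
    · exact (Measurable.of_discrete (f := b)).comp (measurable_pi_apply n)
  · exact tendsto_pi_nhds.2 fun x => (summable_codeTerm hs hb x).hasSum.tendsto_sum_nat

theorem code_cons {s b : ι → ℝ} (hs : ∀ j, |s j| ≤ 1 / 2) (hb : ∀ j, |b j| ≤ 1)
    (z : ι × (ℕ → ι)) : code s b (cons z) = s z.1 * code s b z.2 + b z.1 := by
  rw [code, (summable_codeTerm hs hb _).tsum_eq_zero_add, code, ← tsum_mul_left, add_comm]
  congr 1
  · refine tsum_congr fun n => ?_
    simp only [codeTerm, Finset.prod_range_succ', cons]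
    ring
  · simp [codeTerm, cons]

theorem exists_invariant {s b : ι → ℝ} (hs : ∀ j, |s j| ≤ 1 / 2) (hb : ∀ j, |b j| ≤ 1)
    (w : ι → ℝ≥0∞) (hw : ∑' j, w j = 1) :
    ∃ P : Measure ℝ, IsProbabilityMeasure P ∧
      P = Measure.sum fun j => w j • P.map (fun x => s j * x + b j) := by
  let ν : Measure ι := Measure.sum fun j => w j • Measure.dirac j
  have hν : IsProbabilityMeasure ν := ⟨by
    simp [ν, Measure.sum_apply _ MeasurableSet.univ, hw]⟩
  let μ : Measure (ℕ → ι) := Measure.infinitePi fun _ : ℕ => ν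
  have hc := measurable_code hs hb
  refine ⟨μ.map (code s b), Measure.isProbabilityMeasure_map hc.aemeasurable, ?_⟩
  conv_lhs => rw [show μ = (ν.prod μ).map cons from (map_cons ν).symm]
  rw [Measure.map_map hc measurable_cons]
  have hF : Measurable (code s b ∘ cons) := hc.comp measurable_cons
  rw [Measure.prod_sum_left, Measure.map_sum hF.aemeasurable]
  congr 1
  ext1 j
  rw [Measure.prod_smul_left, Measure.map_smul, Measure.dirac_prod,
    Measure.map_map hF (by fun_prop), Measure.map_map (by fun_prop) hc]
  congr 2
  ext x
  simp [code_cons hs hb]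

end Coding

theorem S_eq (j : ℕ+) :
    S j = fun x => 1 / 2 ^ ((j : ℕ) + 1) * x + (1 - 1 / 2 ^ ((j : ℕ) - 1)) := by
  ext x
  rw [S]; ring

theorem p_nonneg (j : ℕ+) : 0 ≤ p j := by
  unfold p
  split_ifs <;> positivity

theorem hasSum_p : HasSum p 1 := by
  rw [← Equiv.pnatEquivNat.symm.hasSum_iff, hasSum_nat_add_iff' 1 |>.symm]
  have h : HasSum (fun n : ℕ => 3 / 8 * (1 / 2 : ℝ) ^ n) (3 / 8 * 2) :=
    hasSum_geometric_two.mul_left _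
  have e : ∀ n : ℕ, (p ∘ Equiv.pnatEquivNat.symm) (n + 1) = 3 / 8 * (1 / 2 : ℝ) ^ n := fun n => by
    have hne : Nat.succPNat (n + 1) ≠ 1 := by
      intro h
      have := congrArg PNat.val h
      simp at this
    simp only [Function.comp, Equiv.pnatEquivNat_symm_apply, p, if_neg hne, Nat.succPNat_coe,
      Nat.succ_eq_add_one, pow_succ, one_div, inv_pow]
    field_simp
    norm_num
  have e0 : (1 : ℝ) - ∑ i ∈ Finset.range 1, (p ∘ Equiv.pnatEquivNat.symm) i = 3 / 8 * 2 := by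
    have h1 : Nat.succPNat 0 = 1 := rfl
    simp only [Finset.sum_range_one, Function.comp, Equiv.pnatEquivNat_symm_apply, p, h1, if_true]
    norm_num
  rw [e0]
  exact (congrArg (fun f => HasSum f _) (funext e)).mpr h

theorem tsum_ofReal_p : ∑' j, ENNReal.ofReal (p j) = 1 := by
  rw [← ENNReal.ofReal_tsum_of_nonneg p_nonneg hasSum_p.summable, hasSum_p.tsum_eq,
    ENNReal.ofReal_one]

theorem two_pow_succ_inv_le (j : ℕ+) : (1 / 2 ^ ((j : ℕ) + 1) : ℝ) ≤ 1 / 2 := by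
  have : (2 : ℝ) ^ 1 ≤ 2 ^ ((j : ℕ) + 1) := pow_le_pow_right₀ (by norm_num) (by omega)
  exact one_div_le_one_div_of_le (by norm_num) (by linarith)

theorem exists_isInvariant : ∃ P : Measure ℝ, IsInvariant P := by
  let : MeasurableSpace ℕ+ := ⊤
  have : DiscreteMeasurableSpace ℕ+ := ⟨fun _ => trivial⟩
  obtain ⟨P, hP, h⟩ := exists_invariant (ι := ℕ+) (s := fun j => 1 / 2 ^ ((j : ℕ) + 1))
    (b := fun j => 1 - 1 / 2 ^ ((j : ℕ) - 1))
    (fun j => by rw [abs_of_pos (by positivity)]; exact two_pow_succ_inv_le j)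
    (fun j => by
      have h1 : (1 / 2 ^ ((j : ℕ) - 1) : ℝ) ≤ 1 := by
        rw [div_le_one (by positivity)]
        exact one_le_pow₀ (by norm_num)
      have h2 : (0 : ℝ) < 1 / 2 ^ ((j : ℕ) - 1) := by positivity
      rw [abs_le]; constructor <;> linarith)
    (fun j => ENNReal.ofReal (p j)) tsum_ofReal_p
  exact ⟨P, hP, by simpa only [S_eq] using h⟩

theorem IsInvariant.hasSum_charFun {P : Measure ℝ} (hP : IsInvariant P) (t : ℝ) :
    HasSum (fun j => (p j : ℂ) *
      (charFun P (1 / 2 ^ ((j : ℕ) + 1) * t) *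
        Complex.exp ((1 - 1 / 2 ^ ((j : ℕ) - 1) : ℝ) * t * Complex.I))) (charFun P t) := by
  have := hP.isProbabilityMeasure
  have hm : ∀ j, Measurable (S j) := fun j => by rw [S_eq]; fun_prop
  have hint : Integrable (fun x : ℝ => Complex.exp (t * x * Complex.I))
      (Measure.sum fun j : ℕ+ => ENNReal.ofReal (p j) • P.map (S j)) := by
    rw [← hP.eq_sum]
    refine Integrable.of_bound (by fun_prop) 1 (ae_of_all _ fun x => ?_)
    rw [← Complex.ofReal_mul, Complex.norm_exp_ofReal_mul_I]
  have h := hasSum_integral_measure hint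
  rw [← hP.eq_sum, ← charFun_apply_real] at h
  refine (congrArg (fun f => HasSum f _) (funext fun j => ?_)).mpr h
  rw [integral_smul_measure, ENNReal.toReal_ofReal (p_nonneg j),
    integral_map (hm j).aemeasurable (by fun_prop), charFun_apply_real, ← integral_mul_const,
    Complex.real_smul]
  congr 2
  ext x
  rw [← Complex.exp_add, S_eq]
  congr 1
  push_cast
  ring

theorem IsInvariant.norm_sub_le {P Q : Measure ℝ} (hP : IsInvariant P) (hQ : IsInvariant Q)
    {r ε : ℝ} (h : ∀ t, |t| ≤ r → ‖charFun P t - charFun Q t‖ ≤ ε) (t : ℝ) (ht : |t| ≤ 2 * r) :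
    ‖charFun P t - charFun Q t‖ ≤ ε := by
  have hd := (hP.hasSum_charFun t).sub (hQ.hasSum_charFun t)
  have hb : HasSum (fun j => p j * ε) (1 * ε) := hasSum_p.mul_right ε
  rw [one_mul] at hb
  refine hd.norm_le_of_bounded hb fun j => ?_
  rw [← mul_sub, ← sub_mul, norm_mul, norm_mul, ← Complex.ofReal_mul,
    Complex.norm_exp_ofReal_mul_I, mul_one, Complex.norm_real, Real.norm_eq_abs,
    abs_of_nonneg (p_nonneg j)]
  refine mul_le_mul_of_nonneg_left (h _ ?_) (p_nonneg j)
  rw [abs_mul, abs_of_pos (by positivity)]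
  nlinarith [two_pow_succ_inv_le j, abs_nonneg t]

theorem IsInvariant.eq {P Q : Measure ℝ} (hP : IsInvariant P) (hQ : IsInvariant Q) : P = Q := by
  have := hP.isProbabilityMeasure
  have := hQ.isProbabilityMeasure
  refine Measure.ext_of_charFun (funext fun t => ?_)
  rw [← sub_eq_zero, ← norm_le_zero_iff]
  refine le_of_forall_pos_le_add fun ε hε => ?_
  rw [zero_add]
  have hcont : Continuous fun t => charFun P t - charFun Q t :=
    continuous_charFun.sub continuous_charFun
  obtain ⟨δ, hδ, h⟩ := Metric.continuous_iff.1 hcont 0 ε hε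
  have base : ∀ t, |t| ≤ δ / 2 → ‖charFun P t - charFun Q t‖ ≤ ε := fun t ht => by
    have := h t (by rw [Real.dist_eq, sub_zero]; linarith)
    simpa [dist_eq_norm] using this.le
  have step : ∀ n : ℕ, ∀ t, |t| ≤ 2 ^ n * (δ / 2) → ‖charFun P t - charFun Q t‖ ≤ ε := by
    intro n
    induction n with
    | zero => simpa using base
    | succ n ih =>
      intro t ht
      exact hP.norm_sub_le hQ ih t (ht.trans (by rw [pow_succ]; linarith))
  obtain ⟨n, hn⟩ := pow_unbounded_of_one_lt (|t| / (δ / 2)) (one_lt_two (α := ℝ))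
  refine step n t ?_
  rw [div_lt_iff₀ (by positivity)] at hn
  exact hn.le

theorem existsUnique_isInvariant : ∃! P : Measure ℝ, IsInvariant P := by
  obtain ⟨P, hP⟩ := exists_isInvariant
  exact ⟨P, hP, fun Q hQ => hQ.eq hP⟩

/-- The unique Borel probability measure on `ℝ` such that `P = ∑_j p_j P ∘ S_j⁻¹`. -/
noncomputable def P : Measure ℝ := existsUnique_isInvariant.choose

theorem isInvariant_P : IsInvariant P := existsUnique_isInvariant.choose_spec.1

/-! ### Words, cylinder sets and conditional expectations -/

/-- `S_ω = S_{ω_1} ∘ ⋯ ∘ S_{ω_k}`; the empty word gives the identity. -/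
noncomputable def wordMap (ω : List ℕ+) (x : ℝ) : ℝ := ω.foldr S x

/-- `J_ω = S_ω([0, 1])`. -/
def J (ω : List ℕ+) : Set ℝ := wordMap ω '' Set.Icc 0 1

/-- `J_{(ω, ∞)}`, the union of the sets `J_{ω⁻(ω_{|ω|} + j)}` over `j ≥ 1`, where `ω⁻` is the
nonempty word `ω` without its last letter `ω_{|ω|}`. -/
def Jinf (ω : List ℕ+) (hω : ω ≠ []) : Set ℝ :=
  ⋃ j : ℕ+, J (ω.dropLast ++ [ω.getLast hω + j])

/-- `E(X | X ∈ A) = (1 / P(A)) ∫_A x dP` for a random variable `X` with distribution `P`. -/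
noncomputable def condMean (A : Set ℝ) : ℝ := 1 / P.real A * ∫ x in A, x ∂P

/-- `a(ω) = E(X | X ∈ J_ω)`. -/
noncomputable def a (ω : List ℕ+) : ℝ := condMean (J ω)

/-- `a(ω, ∞) = E(X | X ∈ J_{(ω, ∞)})`. -/
noncomputable def aInf (ω : List ℕ+) (hω : ω ≠ []) : ℝ := condMean (Jinf ω hω)

/-! ### Optimal sets of `n`-means -/

/-- The sets of at least one and at most `n` reals. -/
def Codebooks (n : ℕ) : Set (Finset ℝ) := {α | 1 ≤ α.card ∧ α.card ≤ n}

/-- The distortion error `∫ min_{a ∈ α} |x - a|² dP(x)`. -/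
noncomputable def distortion (α : Finset ℝ) : ℝ := ∫ x, ⨅ c : α, |x - c| ^ 2 ∂P

/-- The `n`-th quantization error `V_n`. -/
noncomputable def quantError (n : ℕ) : ℝ := ⨅ α : Codebooks n, distortion α

/-- `α` is an optimal set of `n`-means for `P`. -/
def IsOptimal (n : ℕ) (α : Finset ℝ) : Prop :=
  α ∈ Codebooks n ∧ distortion α = quantError n

end NMeans

namespace NMeans

/-! ### The invariant measure and its tail measure -/

/-! Write Q for `tailMeasure`. Since p_{k+j} is proportional to 2^{-j}, every tail of P is a
rescaled copy of the same Q, so the pair (P, Q) is closed under splitting off the first branch: each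
is a mixture, with weight w on the left part (1/4 for P, 1/2 for Q), of a copy of P on [0, 1/4] and
a copy of Q on [1/2, 1].

The heart of the proof is `IsOptimalFor.exists_split`: if an optimal set in [0, 1], for either
measure, has at least two points, then it has points on both sides of 3/8, and the midpoint of the
two points adjacent to 3/8 lies in the gap [1/4, 1/2]. The energy then decouples, and the points on
each side, rescaled, are optimal for P and for Q (`IsOptimalFor.image_parts`). Strong induction on
the number of points ends at singletons, which must be the means 4/7 and 3/7. Undoing the rescalings
turns these into S_ω(4/7) and into images of 3/7 under a tail map followed by S_ω, which are the
conditional means a(ω) and a(ω, ∞).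

A misplaced midpoint is excluded by exhibiting a cheaper set. If it is left of 1/4, shifting the
left neighbour to the right helps (`IsOptimalFor.half_le_add`). If it is right of 1/2, then [1/2,
5/8] is served badly, and a point at 4/7 repairs this (`IsOptimalFor.false_of_three_consecutive`).
Few points on the left are treated by direct comparison, the most delicate case being two points in
all (`IsOptimalFor.pair_false`). All estimates use only the supports, means and variances of P and Q
on small pieces. -/

theorem S_eq_one_sub (j : ℕ+) (x : ℝ) : S j x = 1 - (2 - x / 2) * (1 / 2) ^ (j : ℕ) := by
  obtain ⟨n, hn⟩ : ∃ n : ℕ, (j : ℕ) = n + 1 := ⟨(j : ℕ) - 1, by have := j.pos; omega⟩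
  rw [S, hn, Nat.add_sub_cancel]
  simp only [one_div, inv_pow, pow_succ, mul_inv]
  ring

theorem measurable_S (j : ℕ+) : Measurable (S j) := by
  rw [S_eq]; fun_prop

theorem continuous_S (j : ℕ+) : Continuous (S j) := by
  rw [S_eq]; fun_prop

theorem S_injective (j : ℕ+) : Function.Injective (S j) := by
  intro x y h
  rw [S_eq_one_sub, S_eq_one_sub] at h
  have h0 : ((1 : ℝ) / 2) ^ (j : ℕ) ≠ 0 := by positivity
  have := mul_right_cancel₀ h0 (sub_right_inj.1 h)
  linarith

theorem half_pow_pos (j : ℕ) : (0 : ℝ) < (1 / 2) ^ j := by positivity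

theorem half_pow_pnat_le (j : ℕ+) : ((1 : ℝ) / 2) ^ (j : ℕ) ≤ 1 / 2 := by
  have := pow_le_pow_of_le_one (by norm_num : (0 : ℝ) ≤ 1 / 2) (by norm_num) j.pos
  rwa [Nat.succ_eq_add_one, zero_add, pow_one] at this

theorem S_lt_S {j k : ℕ+} (h : j < k) {x y : ℝ} (hx : x ≤ 1) (hy : 0 ≤ y) : S j x < S k y := by
  rw [S_eq_one_sub, S_eq_one_sub]
  have h1 : ((1 : ℝ) / 2) ^ (k : ℕ) ≤ (1 / 2) ^ ((j : ℕ) + 1) :=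
    pow_le_pow_of_le_one (by norm_num) (by norm_num) h
  rw [pow_succ] at h1
  nlinarith [half_pow_pos j, half_pow_pos k]

theorem p_one : p 1 = 1 / 4 := by simp [p]

theorem p_add (k j : ℕ+) : p (k + j) = 3 / 2 * (1 / 2) ^ (k : ℕ) * (1 / 2) ^ (j : ℕ) := by
  have h : k + j ≠ 1 := by
    intro h
    have := congrArg PNat.val h
    have h1 := k.pos
    have h2 := j.pos
    simp at this
    omega
  rw [p, if_neg h, PNat.add_coe, pow_succ, pow_add]
  simp only [one_div, inv_pow]
  field_simp

theorem p_pos (j : ℕ+) : 0 < p j := by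
  unfold p
  split_ifs <;> positivity

/-- The probability measure `∑_j 2⁻ʲ P ∘ S_j⁻¹`, a rescaled copy of `P` restricted to the union
of the sets `J_j` with `j ≥ 2`. -/
noncomputable def tailMeasure : Measure ℝ :=
  Measure.sum fun j : ℕ+ => ENNReal.ofReal ((1 / 2) ^ (j : ℕ)) • P.map (S j)

/-- The `k`-th iterate of `x ↦ (x + 1) / 2`, which sends `J_j` to `J_{k + j}`. -/
noncomputable def tailMap (k : ℕ) (x : ℝ) : ℝ := 1 - (1 - x) * (1 / 2) ^ k

theorem tailMap_one (x : ℝ) : tailMap 1 x = (x + 1) / 2 := by simp only [tailMap]; ring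

theorem tailMap_S (k j : ℕ+) (x : ℝ) : tailMap k (S j x) = S (k + j) x := by
  rw [tailMap, S_eq_one_sub, S_eq_one_sub, PNat.add_coe, pow_add]; ring

theorem measurable_tailMap (k : ℕ) : Measurable (tailMap k) := by
  unfold tailMap; fun_prop

theorem tailMap_comp_S (k j : ℕ+) : tailMap k ∘ S j = S (k + j) := funext fun x => tailMap_S k j x

theorem smul_measure_sum (q : ℝ≥0∞) (μ : ℕ+ → Measure ℝ) :
    q • Measure.sum μ = Measure.sum fun j => q • μ j := by
  ext s hs
  simp only [Measure.smul_apply, Measure.sum_apply _ hs, smul_eq_mul, ENNReal.tsum_mul_left]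

instance : IsProbabilityMeasure P := isInvariant_P.isProbabilityMeasure

theorem hasSum_half_pow_pnat : HasSum (fun j : ℕ+ => ((1 : ℝ) / 2) ^ (j : ℕ)) 1 := by
  rw [← Equiv.pnatEquivNat.symm.hasSum_iff]
  have h : HasSum (fun n : ℕ => 1 / 2 * (1 / 2 : ℝ) ^ n) (1 / 2 * 2) :=
    hasSum_geometric_two.mul_left _
  rw [show (1 / 2 * 2 : ℝ) = 1 by norm_num] at h
  refine (congrArg (fun f => HasSum f _) (funext fun n => ?_)).mpr h
  simp only [Function.comp, Equiv.pnatEquivNat_symm_apply, Nat.succPNat_coe, Nat.succ_eq_add_one,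
    pow_succ]
  ring

instance : IsProbabilityMeasure tailMeasure := ⟨by
  have h : ∀ j, P.map (S j) Set.univ = 1 := fun j => by
    rw [Measure.map_apply (measurable_S j) MeasurableSet.univ, Set.preimage_univ, measure_univ]
  simp only [tailMeasure, Measure.sum_apply _ MeasurableSet.univ, Measure.smul_apply, h,
    smul_eq_mul, mul_one]
  rw [← ENNReal.ofReal_tsum_of_nonneg (fun j : ℕ+ => (half_pow_pos j).le)
    hasSum_half_pow_pnat.summable, hasSum_half_pow_pnat.tsum_eq, ENNReal.ofReal_one]⟩

theorem sum_pnat_eq_add (μ : ℕ+ → Measure ℝ) :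
    Measure.sum μ = μ 1 + Measure.sum fun j => μ (1 + j) := by
  ext s hs
  rw [Measure.add_apply, Measure.sum_apply _ hs, Measure.sum_apply _ hs,
    ← Equiv.pnatEquivNat.symm.tsum_eq, tsum_eq_zero_add' ENNReal.summable,
    ← Equiv.pnatEquivNat.symm.tsum_eq (fun j => μ (1 + j) s)]
  congr 1
  refine tsum_congr fun n => ?_
  congr 2
  simp only [Equiv.pnatEquivNat_symm_apply]
  apply PNat.eq
  simp [add_comm]

theorem map_tailMap_tailMeasure (k : ℕ+) : tailMeasure.map (tailMap k) =
    Measure.sum fun j : ℕ+ => ENNReal.ofReal ((1 / 2) ^ (j : ℕ)) • P.map (S (k + j)) := by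
  rw [tailMeasure, Measure.map_sum (measurable_tailMap k).aemeasurable]
  congr 1
  ext1 j
  rw [Measure.map_smul, Measure.map_map (measurable_tailMap k) (measurable_S j), tailMap_comp_S]

/-- The weights p_{1+j} = (3/4) 2^{-j} are geometric. Together with `tailMeasure_eq` this closes the
pair of measures under removal of the first branch. -/
theorem P_eq : P = ENNReal.ofReal (1 / 4) • P.map (S 1) +
    ENNReal.ofReal (3 / 4) • tailMeasure.map (tailMap 1) := by
  have h := map_tailMap_tailMeasure 1
  rw [PNat.one_coe] at h
  conv_lhs => rw [isInvariant_P.eq_sum]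
  rw [sum_pnat_eq_add, p_one, h, smul_measure_sum]
  congr 2
  ext1 j
  rw [p_add, smul_smul, ← ENNReal.ofReal_mul (by norm_num)]
  norm_num

theorem tailMeasure_eq : tailMeasure = ENNReal.ofReal (1 / 2) • P.map (S 1) +
    ENNReal.ofReal (1 / 2) • tailMeasure.map (tailMap 1) := by
  have h := map_tailMap_tailMeasure 1
  rw [PNat.one_coe] at h
  rw [h, smul_measure_sum, tailMeasure, sum_pnat_eq_add, PNat.one_coe, pow_one]
  congr 2
  ext1 j
  rw [smul_smul, ← ENNReal.ofReal_mul (by norm_num), PNat.add_coe, pow_add, PNat.one_coe, pow_one]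

/-! ### Both measures live on [0, 1] -/

theorem P_compl_Icc_le {r : ℝ} (hr : 0 ≤ r) :
    P (Set.Icc (-r) (1 + r))ᶜ ≤ P (Set.Icc (-(4 * r)) (1 + 4 * r))ᶜ := by
  conv_lhs => rw [isInvariant_P.eq_sum]
  rw [Measure.sum_apply _ measurableSet_Icc.compl]
  calc _ ≤ ∑' j, ENNReal.ofReal (p j) * P (Set.Icc (-(4 * r)) (1 + 4 * r))ᶜ := by
        refine ENNReal.tsum_le_tsum fun j => ?_
        rw [Measure.smul_apply, smul_eq_mul, Measure.map_apply (measurable_S j)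
          measurableSet_Icc.compl]
        gcongr
        intro x hx hx'
        refine hx ?_
        have hj := half_pow_pnat_le j
        have hj' := half_pow_pos j
        rw [Set.mem_Icc] at hx' ⊢
        rw [S_eq_one_sub]
        constructor <;> nlinarith
    _ = _ := by rw [ENNReal.tsum_mul_right, tsum_ofReal_p, one_mul]

/-- Each S_j contracts by at least 4 and maps [0, 1] into itself, so the mass outside a
neighbourhood of [0, 1] is at most the mass outside one four times as wide. Iterating, this tends to
0. -/
theorem P_compl_Icc_of_pos {r : ℝ} (hr : 0 < r) : P (Set.Icc (-r) (1 + r))ᶜ = 0 := by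
  have h : ∀ n : ℕ, P (Set.Icc (-r) (1 + r))ᶜ ≤
      P (Set.Icc (-(4 ^ n * r)) (1 + 4 ^ n * r))ᶜ := by
    intro n
    induction n with
    | zero => simp
    | succ n ih =>
      refine ih.trans ((P_compl_Icc_le (by positivity)).trans_eq ?_)
      rw [pow_succ]; ring_nf
  have hanti : Antitone fun n : ℕ => (Set.Icc (-(4 ^ n * r)) (1 + 4 ^ n * r))ᶜ := by
    intro m n hmn
    have : (4 : ℝ) ^ m * r ≤ 4 ^ n * r :=
      mul_le_mul_of_nonneg_right (pow_le_pow_right₀ (by norm_num) hmn) hr.le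
    exact Set.compl_subset_compl.2 (Set.Icc_subset_Icc (by linarith) (by linarith))
  have hlim := tendsto_measure_iInter_atTop (μ := P)
    (fun n => (measurableSet_Icc.compl.nullMeasurableSet :
      NullMeasurableSet (Set.Icc (-(4 ^ n * r)) (1 + 4 ^ n * r))ᶜ P)) hanti
    ⟨0, measure_ne_top _ _⟩
  have hempty : ⋂ n : ℕ, (Set.Icc (-(4 ^ n * r)) (1 + 4 ^ n * r))ᶜ = ∅ := by
    rw [← Set.compl_iUnion, Set.compl_empty_iff, Set.eq_univ_iff_forall]
    intro x
    obtain ⟨n, hn⟩ := pow_unbounded_of_one_lt (|x| / r) (by norm_num : (1 : ℝ) < 4)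
    rw [div_lt_iff₀ hr] at hn
    exact Set.mem_iUnion.2 ⟨n, by linarith [neg_abs_le x], by linarith [le_abs_self x]⟩
  rw [hempty, measure_empty] at hlim
  exact le_antisymm (ge_of_tendsto' hlim h) bot_le

theorem P_compl_Icc : P (Set.Icc 0 1)ᶜ = 0 := by
  have h : (Set.Icc (0 : ℝ) 1)ᶜ ⊆
      ⋃ n : ℕ, (Set.Icc (-(1 / ((n : ℝ) + 1))) (1 + 1 / ((n : ℝ) + 1)))ᶜ := by
    rw [← Set.compl_iInter, Set.compl_subset_compl]
    intro x hx
    rw [Set.mem_iInter] at hx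
    constructor <;> refine le_of_forall_pos_le_add fun ε hε => ?_ <;>
      obtain ⟨n, hn⟩ := exists_nat_one_div_lt hε <;> have := hx n <;> rw [Set.mem_Icc] at this <;>
      linarith
  exact measure_mono_null h (measure_iUnion_null fun n => P_compl_Icc_of_pos (by positivity))

theorem tailMeasure_compl_Icc : tailMeasure (Set.Icc 0 1)ᶜ = 0 := by
  rw [tailMeasure, Measure.sum_apply _ measurableSet_Icc.compl, ENNReal.tsum_eq_zero]
  intro j
  rw [Measure.smul_apply, Measure.map_apply (measurable_S j) measurableSet_Icc.compl]
  refine smul_eq_zero_of_right _ (measure_mono_null (t := (Set.Icc 0 1)ᶜ) (fun x hx hx' => hx ?_)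
    P_compl_Icc)
  have hj := half_pow_pnat_le j
  have hj' := half_pow_pos j
  rw [Set.mem_Icc] at hx' ⊢
  rw [S_eq_one_sub]
  constructor <;> nlinarith

/-! ### Conditional expectations on cylinder sets -/

/-- The intervals J_j are disjoint, so only the k-th term of the invariance equation charges the
image. -/
theorem restrict_image_S (k : ℕ+) {A : Set ℝ} (hA : MeasurableSet A) (hA' : A ⊆ Set.Icc 0 1) :
    P.restrict (S k '' A) = ENNReal.ofReal (p k) • (P.restrict A).map (S k) := by
  have hm : MeasurableSet (S k '' A) :=
    hA.image_of_continuousOn_injOn (continuous_S k).continuousOn (S_injective k).injOn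
  ext s hs
  conv_lhs => rw [isInvariant_P.eq_sum]
  rw [Measure.restrict_apply hs, Measure.sum_apply _ (hs.inter hm), tsum_eq_single k]
  · rw [Measure.smul_apply, Measure.smul_apply, Measure.map_apply (measurable_S k) (hs.inter hm),
      Measure.map_apply (measurable_S k) hs, Measure.restrict_apply (measurable_S k hs),
      Set.preimage_inter, Set.preimage_image_eq _ (S_injective k)]
  · intro j hj
    rw [Measure.smul_apply, Measure.map_apply (measurable_S j) (hs.inter hm)]
    refine smul_eq_zero_of_right _ (measure_mono_null (t := (Set.Icc 0 1)ᶜ) (fun x hx hx' => ?_)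
      P_compl_Icc)
    obtain ⟨y, hy, hxy⟩ := hx.2
    rcases lt_or_gt_of_ne hj with h | h
    · exact (S_lt_S h hx'.2 (hA' hy).1).ne' hxy
    · exact (S_lt_S h (hA' hy).2 hx'.1).ne hxy

theorem wordMap_mem_Icc (ω : List ℕ+) {x : ℝ} (hx : x ∈ Set.Icc (0 : ℝ) 1) :
    wordMap ω x ∈ Set.Icc (0 : ℝ) 1 := by
  induction ω with
  | nil => exact hx
  | cons j ω ih =>
    have hj := half_pow_pnat_le j
    have hj' := half_pow_pos j
    change S j (wordMap ω x) ∈ _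
    rw [Set.mem_Icc] at ih ⊢
    rw [S_eq_one_sub]
    constructor <;> nlinarith

theorem wordMap_affine (ω : List ℕ+) : ∃ s r : ℝ, 0 < s ∧ ∀ x, wordMap ω x = s * x + r := by
  induction ω with
  | nil => exact ⟨1, 0, one_pos, fun x => by simp [wordMap]⟩
  | cons j ω ih =>
    obtain ⟨s, r, hs, h⟩ := ih
    refine ⟨s / 2 * (1 / 2) ^ (j : ℕ), 1 - (2 - r / 2) * (1 / 2) ^ (j : ℕ), by positivity,
      fun x => ?_⟩
    change S j (wordMap ω x) = _
    rw [h, S_eq_one_sub]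
    ring

theorem continuous_wordMap (ω : List ℕ+) : Continuous (wordMap ω) := by
  obtain ⟨s, r, -, h⟩ := wordMap_affine ω
  rw [funext h]; fun_prop

theorem wordMap_injective (ω : List ℕ+) : Function.Injective (wordMap ω) := by
  obtain ⟨s, r, hs, h⟩ := wordMap_affine ω
  intro x y hxy
  rw [h, h] at hxy
  exact mul_left_cancel₀ hs.ne' (add_right_cancel hxy)

theorem restrict_image_wordMap (ω : List ℕ+) {A : Set ℝ} (hA : MeasurableSet A)
    (hA' : A ⊆ Set.Icc 0 1) : ∃ q : ℝ, 0 < q ∧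
      P.restrict (wordMap ω '' A) = ENNReal.ofReal q • (P.restrict A).map (wordMap ω) := by
  induction ω with
  | nil =>
    have h : wordMap [] = id := rfl
    exact ⟨1, one_pos, by simp [h]⟩
  | cons j ω ih =>
    obtain ⟨q, hq, h⟩ := ih
    have hm : MeasurableSet (wordMap ω '' A) :=
      hA.image_of_continuousOn_injOn (continuous_wordMap ω).continuousOn
        (wordMap_injective ω).injOn
    have hsub : wordMap ω '' A ⊆ Set.Icc 0 1 := by
      rintro _ ⟨x, hx, rfl⟩
      exact wordMap_mem_Icc ω (hA' hx)
    refine ⟨p j * q, mul_pos (p_pos j) hq, ?_⟩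
    have hc : wordMap (j :: ω) = S j ∘ wordMap ω := rfl
    rw [hc, Set.image_comp, restrict_image_S j hm hsub, h, Measure.map_smul, smul_smul,
      Measure.map_map (measurable_S j) (continuous_wordMap ω).measurable,
      ENNReal.ofReal_mul (p_nonneg j)]

theorem condMean_of_restrict {A : Set ℝ} {q s r : ℝ} (hq : 0 < q) {ν : Measure ℝ}
    [IsFiniteMeasure ν] (hν : ν Set.univ ≠ 0) (hint : Integrable (fun x => x) ν) {f : ℝ → ℝ}
    (hf : ∀ x, f x = s * x + r) (h : P.restrict A = ENNReal.ofReal q • ν.map f) :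
    condMean A = s * ((∫ x, x ∂ν) / ν.real Set.univ) + r := by
  have hfm : Measurable f := by rw [funext hf]; fun_prop
  have h1 : P.real A = q * ν.real Set.univ := by
    have h2 := congrArg (fun μ : Measure ℝ => (μ Set.univ).toReal) h
    simp only [Measure.restrict_apply MeasurableSet.univ, Set.univ_inter, Measure.smul_apply,
      Measure.map_apply hfm MeasurableSet.univ, Set.preimage_univ, smul_eq_mul,
      ENNReal.toReal_mul, ENNReal.toReal_ofReal hq.le] at h2
    exact h2
  have h0 : ν.real Set.univ ≠ 0 := by
    rw [measureReal_def, Ne, ENNReal.toReal_eq_zero_iff]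
    simp [hν]
  rw [condMean, h1, h, integral_smul_measure, integral_map hfm.aemeasurable (by fun_prop)]
  simp only [hf]
  rw [integral_add (hint.const_mul s) (integrable_const r), integral_const_mul, integral_const,
    ENNReal.toReal_ofReal hq.le, smul_eq_mul, smul_eq_mul]
  field_simp

theorem restrict_P_Icc : P.restrict (Set.Icc 0 1) = P :=
  Measure.restrict_eq_self_of_ae_mem P_compl_Icc

theorem integrable_id_P : Integrable (fun x : ℝ => x) P := by
  refine Integrable.of_bound (by fun_prop) 1 ?_
  have : ∀ᵐ x ∂P, x ∈ Set.Icc (0 : ℝ) 1 := P_compl_Icc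
  filter_upwards [this] with x hx
  rw [Real.norm_eq_abs, abs_of_nonneg hx.1]
  exact hx.2

theorem condMean_image_wordMap (ω : List ℕ+) {A : Set ℝ} (hA : MeasurableSet A)
    (hA' : A ⊆ Set.Icc 0 1) (h0 : P A ≠ 0) :
    condMean (wordMap ω '' A) = wordMap ω (condMean A) := by
  obtain ⟨q, hq, h⟩ := restrict_image_wordMap ω hA hA'
  obtain ⟨s, r, -, hsr⟩ := wordMap_affine ω
  rw [condMean_of_restrict hq (by simpa using h0) integrable_id_P.integrableOn hsr h, hsr,
    condMean]
  simp only [measureReal_restrict_apply_univ]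
  ring

theorem a_eq_wordMap (ω : List ℕ+) : a ω = wordMap ω (∫ x, x ∂P) := by
  have h1 : P (Set.Icc 0 1) = 1 := (prob_compl_eq_zero_iff measurableSet_Icc).1 P_compl_Icc
  rw [a, J, condMean_image_wordMap ω measurableSet_Icc subset_rfl (by simp [h1]), condMean,
    restrict_P_Icc,
    measureReal_def, h1]
  simp

/-- Up to mass, P restricted to the union of the J_{k+j} is the image of `tailMeasure` under
`tailMap k`, and affine maps commute with means. -/
theorem aInf_append_singleton (ω : List ℕ+) (k : ℕ+) :
    aInf (ω ++ [k]) (by simp) = wordMap ω (tailMap k (∫ x, x ∂tailMeasure)) := by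
  set B : Set ℝ := ⋃ j : ℕ+, S (k + j) '' Set.Icc 0 1
  have hmeas : ∀ j : ℕ+, MeasurableSet (S (k + j) '' Set.Icc 0 1) := fun j =>
    measurableSet_Icc.image_of_continuousOn_injOn (continuous_S _).continuousOn
      (S_injective _).injOn
  have hJ : Jinf (ω ++ [k]) (by simp) = wordMap ω '' B := by
    simp only [Jinf, B, Set.image_iUnion, List.dropLast_concat, List.getLast_append_singleton, J]
    refine Set.iUnion_congr fun j => ?_
    rw [← Set.image_comp]
    congr 1
    ext x
    simp [wordMap]
  have hB : P.restrict B =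
      ENNReal.ofReal (3 / 2 * (1 / 2) ^ (k : ℕ)) • tailMeasure.map (tailMap k) := by
    rw [Measure.restrict_iUnion _ hmeas, map_tailMap_tailMeasure, smul_measure_sum]
    · congr 1
      ext1 j
      rw [restrict_image_S _ measurableSet_Icc subset_rfl,
        restrict_P_Icc, p_add, smul_smul,
        ← ENNReal.ofReal_mul (by positivity)]
    · intro i j hij
      rw [Function.onFun, Set.disjoint_left]
      rintro _ ⟨x, hx, rfl⟩ ⟨y, hy, hxy⟩
      rcases lt_or_gt_of_ne hij with h | h
      · exact (S_lt_S (add_lt_add_right h k) hx.2 hy.1).ne' hxy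
      · exact (S_lt_S (add_lt_add_right h k) hy.2 hx.1).ne hxy
  have hsub : B ⊆ Set.Icc 0 1 := by
    refine Set.iUnion_subset fun j => ?_
    rintro _ ⟨x, hx, rfl⟩
    exact wordMap_mem_Icc [k + j] hx
  have h0 : P B ≠ 0 := by
    have := congrArg (fun μ : Measure ℝ => μ Set.univ) hB
    simp only [Measure.restrict_apply MeasurableSet.univ, Set.univ_inter, Measure.smul_apply,
      Measure.map_apply (measurable_tailMap k) MeasurableSet.univ, Set.preimage_univ,
      measure_univ] at this
    rw [this, smul_eq_mul, mul_one, Ne, ENNReal.ofReal_eq_zero, not_le]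
    positivity
  have hint : Integrable (fun x : ℝ => x) tailMeasure := by
    refine Integrable.of_bound (by fun_prop) 1 ?_
    have : ∀ᵐ x ∂tailMeasure, x ∈ Set.Icc (0 : ℝ) 1 := tailMeasure_compl_Icc
    filter_upwards [this] with x hx
    rw [Real.norm_eq_abs, abs_of_nonneg hx.1]
    exact hx.2
  rw [aInf, hJ, condMean_image_wordMap ω (MeasurableSet.iUnion hmeas) hsub h0,
    condMean_of_restrict (s := (1 / 2) ^ (k : ℕ)) (r := 1 - (1 / 2) ^ (k : ℕ)) (by positivity)
      (by simp) hint (fun x => by rw [tailMap]; ring) hB]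
  congr 1
  simp only [probReal_univ, div_one, tailMap]
  ring

/-! ### Integrals of continuous functions along affine images -/

/-- `μ` is a probability measure on `[0, 1]` with mean `m` and variance `v`. -/
structure HasMoments (μ : Measure ℝ) (m v : ℝ) : Prop where
  prob : IsProbabilityMeasure μ
  null : μ (Set.Icc 0 1)ᶜ = 0
  mean : ∫ x, x ∂μ = m
  second : ∫ x, x ^ 2 ∂μ = v + m ^ 2

theorem integrable_of_continuous {μ : Measure ℝ} [IsFiniteMeasure μ] (h : μ (Set.Icc 0 1)ᶜ = 0)
    {f : ℝ → ℝ} (hf : Continuous f) : Integrable f μ := by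
  rw [← Measure.restrict_eq_self_of_ae_mem (μ := μ) (s := Set.Icc 0 1) h]
  exact hf.continuousOn.integrableOn_compact isCompact_Icc

theorem S_one (x : ℝ) : S 1 x = x / 4 := by
  rw [S_eq_one_sub, PNat.one_coe]; ring

/-- `∫ f(r + s x) dμ(x)`. -/
noncomputable def affInt (μ : Measure ℝ) (f : ℝ → ℝ) (r s : ℝ) : ℝ := ∫ x, f (r + s * x) ∂μ

theorem integral_of_eq {μ : Measure ℝ} [IsProbabilityMeasure μ] {u v : ℝ} (hu : 0 ≤ u)
    (hv : 0 ≤ v) (h : μ = ENNReal.ofReal u • P.map (S 1) +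
      ENNReal.ofReal v • tailMeasure.map (tailMap 1)) {f : ℝ → ℝ} (hf : Continuous f) :
    ∫ x, f x ∂μ = u * ∫ x, f (x / 4) ∂P + v * ∫ x, f ((x + 1) / 2) ∂tailMeasure := by
  have hm1 := measurable_S 1
  have hm2 := measurable_tailMap 1
  have i1 : Integrable f (P.map (S 1)) :=
    (integrable_map_measure hf.aestronglyMeasurable hm1.aemeasurable).2
      (integrable_of_continuous P_compl_Icc (hf.comp (continuous_S 1)))
  have i2 : Integrable f (tailMeasure.map (tailMap 1)) :=
    (integrable_map_measure hf.aestronglyMeasurable hm2.aemeasurable).2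
      (integrable_of_continuous tailMeasure_compl_Icc (hf.comp (by unfold tailMap; fun_prop)))
  conv_lhs => rw [h]
  rw [integral_add_measure (i1.smul_measure ENNReal.ofReal_ne_top)
      (i2.smul_measure ENNReal.ofReal_ne_top), integral_smul_measure, integral_smul_measure,
    integral_map hm1.aemeasurable hf.aestronglyMeasurable,
    integral_map hm2.aemeasurable hf.aestronglyMeasurable, ENNReal.toReal_ofReal hu,
    ENNReal.toReal_ofReal hv]
  simp only [S_one, tailMap_one, smul_eq_mul]

theorem integral_P {f : ℝ → ℝ} (hf : Continuous f) :
    ∫ x, f x ∂P = 1 / 4 * ∫ x, f (x / 4) ∂P + 3 / 4 * ∫ x, f ((x + 1) / 2) ∂tailMeasure :=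
  integral_of_eq (by norm_num) (by norm_num) P_eq hf

theorem integral_tailMeasure {f : ℝ → ℝ} (hf : Continuous f) :
    ∫ x, f x ∂tailMeasure =
      1 / 2 * ∫ x, f (x / 4) ∂P + 1 / 2 * ∫ x, f ((x + 1) / 2) ∂tailMeasure :=
  integral_of_eq (by norm_num) (by norm_num) tailMeasure_eq hf

theorem affInt_P {f : ℝ → ℝ} (hf : Continuous f) (r s : ℝ) : affInt P f r s =
    1 / 4 * affInt P f r (s / 4) + 3 / 4 * affInt tailMeasure f (r + s / 2) (s / 2) := by
  rw [affInt, integral_P (f := fun x => f (r + s * x)) (by fun_prop), affInt, affInt]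
  congr 5 <;> ext x <;> ring_nf

theorem affInt_tailMeasure {f : ℝ → ℝ} (hf : Continuous f) (r s : ℝ) : affInt tailMeasure f r s =
    1 / 2 * affInt P f r (s / 4) + 1 / 2 * affInt tailMeasure f (r + s / 2) (s / 2) := by
  rw [affInt, integral_tailMeasure (f := fun x => f (r + s * x)) (by fun_prop), affInt, affInt]
  congr 5 <;> ext x <;> ring_nf

theorem integral_quadratic {μ : Measure ℝ} [IsProbabilityMeasure μ] (h : μ (Set.Icc 0 1)ᶜ = 0)
    (A B C : ℝ) : ∫ x, (A * x ^ 2 + B * x + C) ∂μ = A * ∫ x, x ^ 2 ∂μ + B * ∫ x, x ∂μ + C := by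
  have i : ∀ f : ℝ → ℝ, Continuous f → Integrable f μ := fun f hf => integrable_of_continuous h hf
  rw [integral_add (i _ (by fun_prop)) (i _ (by fun_prop)),
    integral_add (i _ (by fun_prop)) (i _ (by fun_prop)), integral_const_mul, integral_const_mul]
  simp

/-! ### Means and second moments -/

theorem mean_P_and_mean_tailMeasure : ∫ x, x ∂P = 4 / 7 ∧ ∫ x, x ∂tailMeasure = 3 / 7 := by
  have h1 := integral_P (f := fun x => x) continuous_id
  have h2 := integral_tailMeasure (f := fun x => x) continuous_id
  have e1 := integral_quadratic P_compl_Icc 0 (1 / 4) 0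
  have e2 := integral_quadratic tailMeasure_compl_Icc 0 (1 / 2) (1 / 2)
  rw [show (fun x : ℝ => 0 * x ^ 2 + 1 / 4 * x + 0) = fun x => x / 4 by ext; ring] at e1
  rw [show (fun x : ℝ => 0 * x ^ 2 + 1 / 2 * x + 1 / 2) = fun x => (x + 1) / 2 by ext; ring] at e2
  rw [e1, e2] at h1 h2
  constructor <;> linarith

/-- As for the means, the two self-similarity equations form a linear system in two unknowns. -/
theorem second_moments : ∫ x, x ^ 2 ∂P = 288 / 3577 + (4 / 7) ^ 2 ∧
    ∫ x, x ^ 2 ∂tailMeasure = 344 / 3577 + (3 / 7) ^ 2 := by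
  have h1 := integral_P (f := fun x => x ^ 2) (by fun_prop)
  have h2 := integral_tailMeasure (f := fun x => x ^ 2) (by fun_prop)
  have e1 := integral_quadratic P_compl_Icc (1 / 16) 0 0
  have e2 := integral_quadratic tailMeasure_compl_Icc (1 / 4) (1 / 2) (1 / 4)
  rw [show (fun x : ℝ => 1 / 16 * x ^ 2 + 0 * x + 0) = fun x => (x / 4) ^ 2 by ext; ring] at e1
  rw [show (fun x : ℝ => 1 / 4 * x ^ 2 + 1 / 2 * x + 1 / 4) = fun x => ((x + 1) / 2) ^ 2 by
    ext; ring] at e2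
  rw [e1, e2, mean_P_and_mean_tailMeasure.1, mean_P_and_mean_tailMeasure.2] at h1 h2
  constructor <;> linarith

theorem hasMoments_P : HasMoments P (4 / 7) (288 / 3577) :=
  ⟨inferInstance, P_compl_Icc, mean_P_and_mean_tailMeasure.1, second_moments.1⟩

theorem hasMoments_tailMeasure : HasMoments tailMeasure (3 / 7) (344 / 3577) :=
  ⟨inferInstance, tailMeasure_compl_Icc, mean_P_and_mean_tailMeasure.2, second_moments.2⟩

/-! ### Estimates that use only the support, the mean and the variance -/

namespace HasMoments

variable {μ : Measure ℝ} {m v : ℝ}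

theorem integral_mono (h : HasMoments μ m v) {f g : ℝ → ℝ} (hf : Continuous f) (hg : Continuous g)
    (hfg : ∀ x, 0 ≤ x → x ≤ 1 → f x ≤ g x) : ∫ x, f x ∂μ ≤ ∫ x, g x ∂μ := by
  have := h.prob
  refine integral_mono_ae (integrable_of_continuous h.null hf)
    (integrable_of_continuous h.null hg) ?_
  have : ∀ᵐ x ∂μ, x ∈ Set.Icc (0 : ℝ) 1 := h.null
  filter_upwards [this] with x hx using hfg x hx.1 hx.2

theorem affInt_quadratic (h : HasMoments μ m v) (A B C t r s : ℝ) :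
    affInt μ (fun y => A * (y - t) ^ 2 + B * (y - t) + C) r s =
      A * (s ^ 2 * v + (r + s * m - t) ^ 2) + B * (r + s * m - t) + C := by
  have := h.prob
  have e := integral_quadratic h.null (A * s ^ 2) (2 * A * s * (r - t) + B * s)
    (A * (r - t) ^ 2 + B * (r - t) + C)
  rw [h.mean, h.second] at e
  rw [affInt, show (fun x => A * (r + s * x - t) ^ 2 + B * (r + s * x - t) + C) = fun x =>
    A * s ^ 2 * x ^ 2 + (2 * A * s * (r - t) + B * s) * x + (A * (r - t) ^ 2 + B * (r - t) + C) by
      ext; ring, e]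
  ring

theorem affInt_mono (h : HasMoments μ m v) {f g : ℝ → ℝ} (hf : Continuous f) (hg : Continuous g)
    {r s : ℝ} (hs : 0 ≤ s) (hfg : ∀ y, r ≤ y → y ≤ r + s → f y ≤ g y) :
    affInt μ f r s ≤ affInt μ g r s :=
  h.integral_mono (by fun_prop) (by fun_prop) fun x h0 h1 => hfg _ (by nlinarith) (by nlinarith)

/-- On a small piece the change caused by a competitor is bounded by a quadratic polynomial, whose
integral is determined by the moments. -/
theorem affInt_le_add (h : HasMoments μ m v) {f g : ℝ → ℝ} (hf : Continuous f) (hg : Continuous g)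
    {r s A B C t : ℝ} (hs : 0 ≤ s)
    (hfg : ∀ y, r ≤ y → y ≤ r + s → f y ≤ g y + (A * (y - t) ^ 2 + B * (y - t) + C)) :
    affInt μ f r s ≤ affInt μ g r s +
      (A * (s ^ 2 * v + (r + s * m - t) ^ 2) + B * (r + s * m - t) + C) := by
  have := h.prob
  rw [← h.affInt_quadratic A B C t r s, affInt, affInt, affInt, ← integral_add
    (integrable_of_continuous h.null (by fun_prop)) (integrable_of_continuous h.null (by fun_prop))]
  exact h.affInt_mono (f := f) (g := fun y => g y + (A * (y - t) ^ 2 + B * (y - t) + C)) hf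
    (by fun_prop) hs hfg

theorem affInt_le_add_const (h : HasMoments μ m v) {f g : ℝ → ℝ} (hf : Continuous f)
    (hg : Continuous g) {r s C : ℝ} (hs : 0 ≤ s) (hfg : ∀ y, r ≤ y → y ≤ r + s → f y ≤ g y + C) :
    affInt μ f r s ≤ affInt μ g r s + C := by
  have := h.affInt_le_add hf hg (A := 0) (B := 0) (C := C) (t := 0) hs
    fun y h0 h1 => (hfg y h0 h1).trans_eq (by ring)
  linarith

theorem affInt_le_sq (h : HasMoments μ m v) {f : ℝ → ℝ} (hf : Continuous f) {r s t : ℝ}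
    (hs : 0 ≤ s) (hft : ∀ y, r ≤ y → y ≤ r + s → f y ≤ (y - t) ^ 2) :
    affInt μ f r s ≤ s ^ 2 * v + (r + s * m - t) ^ 2 := by
  have e := h.affInt_quadratic 1 0 0 t r s
  have := h.affInt_mono hf (g := fun y => 1 * (y - t) ^ 2 + 0 * (y - t) + 0) (by fun_prop) hs
    fun y h0 h1 => (hft y h0 h1).trans_eq (by ring)
  linarith

theorem sq_le_affInt (h : HasMoments μ m v) {f : ℝ → ℝ} (hf : Continuous f) {r s t : ℝ}
    (hs : 0 ≤ s) (hft : ∀ y, r ≤ y → y ≤ r + s → (y - t) ^ 2 ≤ f y) :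
    s ^ 2 * v + (r + s * m - t) ^ 2 ≤ affInt μ f r s := by
  have e := h.affInt_quadratic 1 0 0 t r s
  have := h.affInt_mono (f := fun y => 1 * (y - t) ^ 2 + 0 * (y - t) + 0) (by fun_prop) hf hs
    fun y h0 h1 => le_trans (by ring_nf; rfl) (hft y h0 h1)
  linarith

theorem const_le_affInt (h : HasMoments μ m v) {f : ℝ → ℝ} (hf : Continuous f) {r s C : ℝ}
    (hs : 0 ≤ s) (hft : ∀ y, r ≤ y → y ≤ r + s → C ≤ f y) : C ≤ affInt μ f r s := by
  have e := h.affInt_quadratic 0 0 C 0 r s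
  have := h.affInt_mono (f := fun y => 0 * (y - 0) ^ 2 + 0 * (y - 0) + C) (by fun_prop) hf hs
    fun y h0 h1 => le_trans (by ring_nf; rfl) (hft y h0 h1)
  linarith

end HasMoments

/-! ### Distance to a finite set and optimal sets -/

/-- The squared distance from `x` to the finite set `α`. -/
noncomputable def sqDist (α : Finset ℝ) (x : ℝ) : ℝ := ⨅ c : α, |x - c| ^ 2

theorem sqDist_le {α : Finset ℝ} {c : ℝ} (hc : c ∈ α) (x : ℝ) : sqDist α x ≤ (x - c) ^ 2 := by
  rw [← sq_abs (x - c)]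
  exact ciInf_le (f := fun c : α => |x - c| ^ 2) (Set.finite_range _).bddBelow ⟨c, hc⟩

theorem exists_sqDist_eq {α : Finset ℝ} (h : α.Nonempty) (x : ℝ) :
    ∃ c ∈ α, sqDist α x = (x - c) ^ 2 := by
  have := h.to_subtype
  obtain ⟨c, hc⟩ := exists_eq_ciInf_of_finite (f := fun c : α => |x - c| ^ 2)
  exact ⟨c, c.2, by rw [sqDist, ← hc, sq_abs]⟩

theorem le_sqDist {α : Finset ℝ} (h : α.Nonempty) {x r : ℝ} (hr : ∀ c ∈ α, r ≤ (x - c) ^ 2) :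
    r ≤ sqDist α x := by
  obtain ⟨c, hc, e⟩ := exists_sqDist_eq h x
  exact (hr c hc).trans_eq e.symm

theorem sqDist_nonneg (α : Finset ℝ) (x : ℝ) : 0 ≤ sqDist α x :=
  Real.iInf_nonneg fun _ => by positivity

theorem continuous_sqDist {α : Finset ℝ} (h : α.Nonempty) : Continuous (sqDist α) := by
  have := h.to_subtype
  unfold sqDist
  simp_rw [← Finset.inf'_univ_eq_ciInf]
  exact Continuous.finset_inf'_apply _ fun i _ => by fun_prop

theorem sqDist_anti {α β : Finset ℝ} (hα : α.Nonempty) (h : α ⊆ β) (x : ℝ) :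
    sqDist β x ≤ sqDist α x :=
  le_sqDist hα fun _ hc => sqDist_le (h hc) x

/-- `α` minimizes `∫ d(x, α)² dμ` among the nonempty sets with at most as many elements. -/
def IsOptimalFor (μ : Measure ℝ) (α : Finset ℝ) : Prop :=
  α.Nonempty ∧ ∀ β : Finset ℝ, β.Nonempty → β.card ≤ α.card →
    ∫ x, sqDist α x ∂μ ≤ ∫ x, sqDist β x ∂μ

/-- Comparing with sets of size at most `α.card` removes n and gives a notion that the two parts of
α can inherit. -/
theorem IsOptimal.isOptimalFor {n : ℕ} {α : Finset ℝ} (h : IsOptimal n α) : IsOptimalFor P α := by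
  refine ⟨Finset.card_pos.1 h.1.1, fun β hβ hc => ?_⟩
  change distortion α ≤ distortion β
  rw [h.2]
  exact ciInf_le (f := fun β : Codebooks n => distortion β)
    ⟨0, by rintro _ ⟨β, rfl⟩; exact integral_nonneg fun x => sqDist_nonneg _ x⟩
    ⟨β, Finset.card_pos.2 hβ, hc.trans h.1.2⟩

/-! ### Mixtures of the two measures and competitors for optimal sets -/

/-- `μ` is the mixture with weight `w` of the copies of `P` on `[0, 1/4]` and of `tailMeasure` on
`[1/2, 1]`. -/
structure IsMixture (μ : Measure ℝ) (w : ℝ) : Prop where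
  le : 1 / 4 ≤ w
  le_half : w ≤ 1 / 2
  eq : ∀ f : ℝ → ℝ, Continuous f →
    ∫ x, f x ∂μ = w * affInt P f 0 (1 / 4) + (1 - w) * affInt tailMeasure f (1 / 2) (1 / 2)

theorem isMixture_P : IsMixture P (1 / 4) := by
  refine ⟨le_rfl, by norm_num, fun f hf => ?_⟩
  have := affInt_P hf 0 1
  norm_num [affInt] at this ⊢
  exact this

theorem isMixture_tailMeasure : IsMixture tailMeasure (1 / 2) := by
  refine ⟨by norm_num, le_rfl, fun f hf => ?_⟩
  have := affInt_tailMeasure hf 0 1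
  norm_num [affInt] at this ⊢
  exact this

section

variable {f : ℝ → ℝ} (hf : Continuous f)
include hf

theorem affInt_right : affInt tailMeasure f (1 / 2) (1 / 2) =
    1 / 2 * affInt P f (1 / 2) (1 / 8) + 1 / 2 * affInt tailMeasure f (3 / 4) (1 / 4) := by
  rw [affInt_tailMeasure hf]; norm_num

theorem affInt_right_left : affInt P f (1 / 2) (1 / 8) = 1 / 4 * affInt P f (1 / 2) (1 / 32) +
    3 / 8 * affInt P f (9 / 16) (1 / 64) + 3 / 8 * affInt tailMeasure f (19 / 32) (1 / 32) := by
  rw [affInt_P hf, affInt_tailMeasure hf]; ring_nf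

/-- Each deeper expansion peels one more copy of P off the remaining tail, so that a given midpoint
can be located between two pieces. -/
theorem affInt_left₂ : affInt P f 0 (1 / 4) = 1 / 4 * affInt P f 0 (1 / 16) +
    3 / 8 * affInt P f (1 / 8) (1 / 32) + 3 / 8 * affInt tailMeasure f (3 / 16) (1 / 16) := by
  rw [affInt_P hf, affInt_tailMeasure hf]; ring_nf

theorem affInt_left₃ : affInt P f 0 (1 / 4) = 1 / 4 * affInt P f 0 (1 / 16) +
    3 / 8 * affInt P f (1 / 8) (1 / 32) + 3 / 16 * affInt P f (3 / 16) (1 / 64) +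
    3 / 16 * affInt tailMeasure f (7 / 32) (1 / 32) := by
  rw [affInt_left₂ hf, affInt_tailMeasure hf (3 / 16)]; ring_nf

theorem affInt_left₄ : affInt P f 0 (1 / 4) = 1 / 4 * affInt P f 0 (1 / 16) +
    3 / 8 * affInt P f (1 / 8) (1 / 32) + 3 / 16 * affInt P f (3 / 16) (1 / 64) +
    3 / 32 * affInt P f (7 / 32) (1 / 128) + 3 / 32 * affInt tailMeasure f (15 / 64) (1 / 64) := by
  rw [affInt_left₃ hf, affInt_tailMeasure hf (7 / 32)]; ring_nf

end

section

variable {μ : Measure ℝ} {w : ℝ} {α : Finset ℝ}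

/-- The competitor consists of the means of the two parts, so only the variances 288/3577 and
344/3577 remain, scaled by 1/16 and 1/4. -/
theorem IsOptimalFor.le_of_two_le_card (hμ : IsMixture μ w) (h : IsOptimalFor μ α)
    (hα : 2 ≤ α.card) :
    ∫ x, sqDist α x ∂μ ≤ w * (18 / 3577) + (1 - w) * (86 / 3577) := by
  have hne : ({1 / 7, 5 / 7} : Finset ℝ).Nonempty := by simp
  refine (h.2 {1 / 7, 5 / 7} hne (Finset.card_le_two.trans hα)).trans ?_
  have hcont := continuous_sqDist hne
  rw [hμ.eq _ hcont]
  have h1 := hasMoments_P.affInt_le_sq hcont (r := 0) (s := 1 / 4) (t := 1 / 7) (by norm_num)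
    fun y _ _ => sqDist_le (by simp) y
  have h2 := hasMoments_tailMeasure.affInt_le_sq hcont (r := 1 / 2) (s := 1 / 2) (t := 5 / 7)
    (by norm_num) fun y _ _ => sqDist_le (by simp) y
  have := hμ.le
  have := hμ.le_half
  norm_num at h1 h2
  gcongr
  linarith

/-- Here the right part is split once more: 4/7 and 6/7 are the means on [1/2, 5/8] and [3/4, 1]. -/
theorem IsOptimalFor.le_of_three_le_card (hμ : IsMixture μ w) (h : IsOptimalFor μ α)
    (hα : 3 ≤ α.card) :
    ∫ x, sqDist α x ∂μ ≤ w * (18 / 3577) + (1 - w) * (13 / 3577) := by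
  have hne : ({1 / 7, 4 / 7, 6 / 7} : Finset ℝ).Nonempty := by simp
  refine (h.2 {1 / 7, 4 / 7, 6 / 7} hne (Finset.card_le_three.trans hα)).trans ?_
  have hcont := continuous_sqDist hne
  rw [hμ.eq _ hcont, affInt_right hcont]
  have h1 := hasMoments_P.affInt_le_sq hcont (r := 0) (s := 1 / 4) (t := 1 / 7) (by norm_num)
    fun y _ _ => sqDist_le (by simp) y
  have h2 := hasMoments_P.affInt_le_sq hcont (r := 1 / 2) (s := 1 / 8) (t := 4 / 7)
    (by norm_num) fun y _ _ => sqDist_le (by simp) y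
  have h3 := hasMoments_tailMeasure.affInt_le_sq hcont (r := 3 / 4) (s := 1 / 4) (t := 6 / 7)
    (by norm_num) fun y _ _ => sqDist_le (by simp) y
  have := hμ.le
  have := hμ.le_half
  norm_num at h1 h2 h3
  gcongr
  · linarith
  · linarith

/-- Otherwise the right part, of mean 5/7, pays at least (5/7 - 3/8)² beyond its variance. -/
theorem IsOptimalFor.exists_gt (hμ : IsMixture μ w) (h : IsOptimalFor μ α) (hα : 2 ≤ α.card) :
    ∃ c ∈ α, 3 / 8 < c := by
  by_contra! hc
  have hcont := continuous_sqDist h.1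
  have h0 := h.le_of_two_le_card hμ hα
  rw [hμ.eq _ hcont] at h0
  have h1 := hasMoments_P.const_le_affInt hcont (r := 0) (s := 1 / 4) (by norm_num)
    fun y _ _ => sqDist_nonneg α y
  have h2 := hasMoments_tailMeasure.sq_le_affInt hcont (r := 1 / 2) (s := 1 / 2) (t := 3 / 8)
    (by norm_num) fun y hy _ => le_sqDist h.1 fun c hc' => by nlinarith [hc c hc']
  have := hμ.le
  have := hμ.le_half
  norm_num at h2
  nlinarith

/-! ### Optimal sets with at least three points -/

/-- Reflection in 1/2: for y ≥ 1/2 the point 1 - b is no farther than b, and points beyond 1 - b ≥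
5/8 are farther still. So when the midpoint exceeds 1/2, [1/2, 5/8] is served no better than by 1 -
b alone. -/
theorem sq_le_sqDist_right (hα : α.Nonempty) {b : ℝ} (hb : b ≤ 3 / 8)
    (h : ∀ d ∈ α, d ≤ b ∨ 1 - b < d) {y : ℝ} (h0 : 1 / 2 ≤ y) (h1 : y ≤ 5 / 8) :
    (y - (1 - b)) ^ 2 ≤ sqDist α y := by
  refine le_sqDist hα fun d hd => ?_
  rcases h d hd with h | h <;> nlinarith

theorem IsOptimalFor.false_of_forall_gt (hμ : IsMixture μ w) (h : IsOptimalFor μ α)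
    (hα : 3 ≤ α.card) (hc : ∀ c ∈ α, 3 / 8 < c) : False := by
  have hcont := continuous_sqDist h.1
  have h0 := h.le_of_three_le_card hμ hα
  rw [hμ.eq _ hcont] at h0
  have h1 := hasMoments_P.sq_le_affInt hcont (r := 0) (s := 1 / 4) (t := 3 / 8) (by norm_num)
    fun y _ hy => le_sqDist h.1 fun c hc' => by nlinarith [hc c hc']
  have h2 := hasMoments_tailMeasure.const_le_affInt hcont (r := 1 / 2) (s := 1 / 2) (by norm_num)
    fun y _ _ => sqDist_nonneg α y
  have := hμ.le
  have := hμ.le_half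
  norm_num at h1
  nlinarith

theorem IsOptimalFor.false_of_left_singleton (hμ : IsMixture μ w) (h : IsOptimalFor μ α)
    (hα : 3 ≤ α.card) {b : ℝ} (hb : b ≤ 3 / 8) (hc : ∀ d ∈ α, d = b ∨ 1 - b < d) : False := by
  have hcont := continuous_sqDist h.1
  have h0 := h.le_of_three_le_card hμ hα
  rw [hμ.eq _ hcont, affInt_right hcont] at h0
  have h1 := hasMoments_P.sq_le_affInt hcont (r := 0) (s := 1 / 4) (t := b) (by norm_num)
    fun y _ hy => le_sqDist h.1 fun d hd => by
      rcases hc d hd with rfl | h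
      · rfl
      · nlinarith
  have h2 := hasMoments_P.sq_le_affInt hcont (r := 1 / 2) (s := 1 / 8) (t := 1 - b) (by norm_num)
    fun y hy hy' => sq_le_sqDist_right h.1 hb (fun d hd => (hc d hd).imp_left le_of_eq) hy
      (by linarith)
  have h3 := hasMoments_tailMeasure.const_le_affInt hcont (r := 3 / 4) (s := 1 / 4) (by norm_num)
    fun y _ _ => sqDist_nonneg α y
  have hw := hμ.le
  have hw' := hμ.le_half
  norm_num at h1 h2
  have h4 : w * (18 / 3577 + (1 / 7 - b) ^ 2) ≤ w * affInt P (sqDist α) 0 (1 / 4) := by gcongr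
  have h5 : (1 - w) * (1 / 2 * (9 / 7154 + (4 / 7 - (1 - b)) ^ 2)) ≤ (1 - w) *
      (1 / 2 * affInt P (sqDist α) (1 / 2) (1 / 8) +
        1 / 2 * affInt tailMeasure (sqDist α) (3 / 4) (1 / 4)) := by
    gcongr
    · linarith
    · linarith
  -- Both excesses (b - 1/7)² and (b - 3/7)² carry weight at least 1/4; their sum is smallest at b =
  -- 2/7 and still exceeds the allowance.
  nlinarith [sq_nonneg (b - 2 / 7), mul_nonneg (sub_nonneg.2 hw) (sq_nonneg (1 / 7 - b)),
    mul_nonneg (sub_nonneg.2 hw') (sq_nonneg (4 / 7 - (1 - b)))]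

/-! ### Moving a point to the right -/

/-- Only those x served by the removed point c need an argument; all others keep their nearest
point. -/
theorem sqDist_insert_erase_le {c : ℝ} {x y ε : ℝ} (hα : α.Nonempty)
    (h : (sqDist α x = (x - c) ^ 2) → (sqDist (insert y (α.erase c)) x ≤ (x - c) ^ 2 + ε))
    (hε : 0 ≤ ε) : sqDist (insert y (α.erase c)) x ≤ sqDist α x + ε := by
  obtain ⟨d, hd, e⟩ := exists_sqDist_eq hα x
  rw [e]
  rcases eq_or_ne d c with rfl | hne
  · exact h e
  · linarith [sqDist_le (Finset.mem_insert_of_mem (Finset.mem_erase.2 ⟨hne, hd⟩) :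
      d ∈ insert y (α.erase c)) x]

theorem card_insert_erase_le {c : ℝ} (hc : c ∈ α) (y : ℝ) :
    (insert y (α.erase c)).card ≤ α.card := by
  have := Finset.card_insert_le y (α.erase c)
  have := Finset.card_erase_add_one hc
  omega

/-- The added term is (x - e - ε)² - (x - e)². Between e and the midpoint, e is the nearest point,
so the bound is the true gain; left of e the term is positive and is merely an upper bound for the
loss. -/
theorem sqDist_shift_le_add {e b ε x : ℝ} (he : e ∈ α) (hd : ∀ d ∈ α, d ≤ e ∨ b ≤ d) (hε : 0 < ε)
    (hx : x ≤ (e + b) / 2) :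
    sqDist (insert (e + ε) (α.erase e)) x ≤
      sqDist α x + (0 * (x - e) ^ 2 + -2 * ε * (x - e) + ε ^ 2) := by
  have h1 : sqDist (insert (e + ε) (α.erase e)) x ≤ (x - (e + ε)) ^ 2 := sqDist_le (by simp) x
  rcases le_or_gt x e with h | h
  · refine sqDist_insert_erase_le ⟨e, he⟩ (fun _ => ?_) (by nlinarith)
    linarith
  · have h2 : (x - e) ^ 2 ≤ sqDist α x := le_sqDist ⟨e, he⟩ fun d hd' => by
      rcases hd d hd' with h | h <;> nlinarith
    linarith

theorem sqDist_shift_le {e ε x : ℝ} (he : e ∈ α) (hε : 0 < ε) (hx : e + ε ≤ x) :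
    sqDist (insert (e + ε) (α.erase e)) x ≤ sqDist α x + 0 := by
  have h1 : sqDist (insert (e + ε) (α.erase e)) x ≤ (x - (e + ε)) ^ 2 := sqDist_le (by simp) x
  exact sqDist_insert_erase_le ⟨e, he⟩ (fun _ => by nlinarith) le_rfl

/-- A point lying left of the centroid of pieces reaching no farther than its midpoint with b gains
by moving towards that centroid, and mass farther right does not suffer. A first bound on e pushes
the midpoint past a further piece, which improves the bound. -/
theorem IsOptimalFor.ge_of_consecutive (hμ : IsMixture μ w) (h : IsOptimalFor μ α) {e b : ℝ}
    (he : e ∈ α) (he0 : 0 ≤ e) (hd : ∀ d ∈ α, d ≤ e ∨ b ≤ d) (hb : 8 / 25 ≤ b) :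
    61 / 500 ≤ e := by
  have hw := hμ.le
  have hw' := hμ.le_half
  have hcont := continuous_sqDist h.1
  have key : ∀ ε, 0 < ε → e + ε ≤ 1 / 5 →
      affInt P (sqDist α) 0 (1 / 4) ≤
        affInt P (sqDist (insert (e + ε) (α.erase e))) 0 (1 / 4) := by
    intro ε hε hε'
    have hne : (insert (e + ε) (α.erase e)).Nonempty := Finset.insert_nonempty _ _
    have h0 := h.2 _ hne (card_insert_erase_le he (e + ε))
    have hcont' := continuous_sqDist hne
    rw [hμ.eq _ hcont, hμ.eq _ hcont'] at h0
    have h1 := hasMoments_tailMeasure.affInt_le_add_const hcont' hcont (r := 1 / 2) (s := 1 / 2)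
      (by norm_num) fun y hy _ => sqDist_shift_le he hε (by linarith)
    nlinarith
  have he1 : 1 / 10 ≤ e := by
    by_contra! hlt
    -- 1/10 is the centroid of the pieces on [0, 1/16] and [1/8, 5/32]; the midpoint is at least
    -- 4/25 > 5/32.
    obtain ⟨ε, rfl⟩ : ∃ ε, e = 1 / 10 - ε := ⟨1 / 10 - e, by ring⟩
    have hε : 0 < ε := by linarith
    have h0 := key ε hε (by linarith)
    have hne : (insert (1 / 10 - ε + ε) (α.erase (1 / 10 - ε))).Nonempty :=
      Finset.insert_nonempty _ _
    have hcont' := continuous_sqDist hne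
    rw [affInt_left₂ hcont, affInt_left₂ hcont'] at h0
    have h1 := hasMoments_P.affInt_le_add hcont' hcont (r := 0) (s := 1 / 16) (by norm_num)
      fun y _ hy => sqDist_shift_le_add he hd hε (by linarith)
    have h2 := hasMoments_P.affInt_le_add hcont' hcont (r := 1 / 8) (s := 1 / 32) (by norm_num)
      fun y _ hy => sqDist_shift_le_add he hd hε (by linarith)
    have h3 := hasMoments_tailMeasure.affInt_le_add_const hcont' hcont (r := 3 / 16) (s := 1 / 16)
      (by norm_num) fun y hy _ => sqDist_shift_le he hε (by linarith)
    nlinarith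
  by_contra! hlt
  -- Now the midpoint is at least 21/100 > 13/64, so the piece on [3/16, 13/64] joins; the centroid
  -- becomes 89/728, slightly above 61/500.
  obtain ⟨ε, rfl⟩ : ∃ ε, e = 61 / 500 - ε := ⟨61 / 500 - e, by ring⟩
  have hε : 0 < ε := by linarith
  have h0 := key ε hε (by linarith)
  have hne : (insert (61 / 500 - ε + ε) (α.erase (61 / 500 - ε))).Nonempty :=
    Finset.insert_nonempty _ _
  have hcont' := continuous_sqDist hne
  rw [affInt_left₃ hcont, affInt_left₃ hcont'] at h0
  have h1 := hasMoments_P.affInt_le_add hcont' hcont (r := 0) (s := 1 / 16) (by norm_num)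
    fun y _ hy => sqDist_shift_le_add he hd hε (by linarith)
  have h2 := hasMoments_P.affInt_le_add hcont' hcont (r := 1 / 8) (s := 1 / 32) (by norm_num)
    fun y _ hy => sqDist_shift_le_add he hd hε (by linarith)
  have h3 := hasMoments_P.affInt_le_add hcont' hcont (r := 3 / 16) (s := 1 / 64) (by norm_num)
    fun y _ hy => sqDist_shift_le_add he hd hε (by linarith)
  have h4 := hasMoments_tailMeasure.affInt_le_add_const hcont' hcont (r := 7 / 32) (s := 1 / 32)
    (by norm_num) fun y hy _ => sqDist_shift_le he hε (by linarith)
  nlinarith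

theorem IsOptimalFor.half_le_add (hμ : IsMixture μ w) (h : IsOptimalFor μ α) {e b : ℝ}
    (he : e ∈ α) (he0 : 0 ≤ e) (hd : ∀ d ∈ α, d ≤ e ∨ b ≤ d) (hb : 3 / 8 ≤ b) :
    1 / 2 ≤ e + b := by
  have hw := hμ.le
  have hw' := hμ.le_half
  have he1 := h.ge_of_consecutive hμ he he0 hd (by linarith)
  by_contra! hlt
  have hcont := continuous_sqDist h.1
  -- The piece on [7/32, 29/128] joins as well: the centroid is 431/3248, just above 33/250, whereas
  -- the assumption forces e < 1/8.
  obtain ⟨ε, rfl⟩ : ∃ ε, e = 33 / 250 - ε := ⟨33 / 250 - e, by ring⟩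
  have hε : 0 < ε := by linarith
  have hne : (insert (33 / 250 - ε + ε) (α.erase (33 / 250 - ε))).Nonempty :=
    Finset.insert_nonempty _ _
  have h0 := h.2 _ hne (card_insert_erase_le he _)
  have hcont' := continuous_sqDist hne
  rw [hμ.eq _ hcont, hμ.eq _ hcont', affInt_left₄ hcont, affInt_left₄ hcont'] at h0
  have h1 := hasMoments_P.affInt_le_add hcont' hcont (r := 0) (s := 1 / 16) (by norm_num)
    fun y _ hy => sqDist_shift_le_add he hd hε (by linarith)
  have h2 := hasMoments_P.affInt_le_add hcont' hcont (r := 1 / 8) (s := 1 / 32) (by norm_num)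
    fun y _ hy => sqDist_shift_le_add he hd hε (by linarith)
  have h3 := hasMoments_P.affInt_le_add hcont' hcont (r := 3 / 16) (s := 1 / 64) (by norm_num)
    fun y _ hy => sqDist_shift_le_add he hd hε (by linarith)
  have h4 := hasMoments_P.affInt_le_add hcont' hcont (r := 7 / 32) (s := 1 / 128) (by norm_num)
    fun y _ hy => sqDist_shift_le_add he hd hε (by linarith)
  have h5 := hasMoments_tailMeasure.affInt_le_add_const hcont' hcont (r := 15 / 64) (s := 1 / 64)
    (by norm_num) fun y hy _ => sqDist_shift_le he hε (by linarith)
  have h6 := hasMoments_tailMeasure.affInt_le_add_const hcont' hcont (r := 1 / 2) (s := 1 / 2)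
    (by norm_num) fun y hy _ => sqDist_shift_le he hε (by linarith)
  set β := insert (33 / 250 - ε + ε) (α.erase (33 / 250 - ε))
  have h7 : 1 / 4 * affInt P (sqDist β) 0 (1 / 16) + 3 / 8 * affInt P (sqDist β) (1 / 8) (1 / 32) +
      3 / 16 * affInt P (sqDist β) (3 / 16) (1 / 64) +
      3 / 32 * affInt P (sqDist β) (7 / 32) (1 / 128) +
      3 / 32 * affInt tailMeasure (sqDist β) (15 / 64) (1 / 64) <
      1 / 4 * affInt P (sqDist α) 0 (1 / 16) + 3 / 8 * affInt P (sqDist α) (1 / 8) (1 / 32) +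
      3 / 16 * affInt P (sqDist α) (3 / 16) (1 / 64) +
      3 / 32 * affInt P (sqDist α) (7 / 32) (1 / 128) +
      3 / 32 * affInt tailMeasure (sqDist α) (15 / 64) (1 / 64) := by
    nlinarith
  nlinarith

/-! ### Excluding a midpoint to the right of the gap -/

theorem sqDist_insert_erase_le_of_le {b c x y : ℝ} (hα : α.Nonempty) (hbc : b < c) (hc : c ∈ α)
    (hx : b + c ≤ 2 * x) : sqDist (insert y (α.erase b)) x ≤ sqDist α x + 0 := by
  refine sqDist_insert_erase_le hα (fun _ => ?_) le_rfl
  have := sqDist_le (Finset.mem_insert_of_mem (Finset.mem_erase.2 ⟨hbc.ne', hc⟩) :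
    c ∈ insert y (α.erase b)) x
  nlinarith

/-- If b is small, all points up to b, at least two of them, can be traded for 1/7 and 4/7. The mass
on [3/4, 1] is unharmed, as c serves it at least as well as they did. -/
theorem IsOptimalFor.lt_of_add_gt_one (hμ : IsMixture μ w) (h : IsOptimalFor μ α) {b c : ℝ}
    (hb : b ∈ α) (hc : c ∈ α) (hd : ∀ d ∈ α, d ≤ b ∨ c ≤ d) (hb' : b ≤ 3 / 8) (hbc : 1 < b + c)
    (hc' : c ≤ 1) {e : ℝ} (he : e ∈ α) (heb : e < b) : 8 / 25 < b := by
  by_contra! hlt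
  have hw := hμ.le
  have hw' := hμ.le_half
  have hcont := continuous_sqDist h.1
  set β : Finset ℝ := insert (1 / 7) (insert (4 / 7) (α.filter (b < ·)))
  have hcard : β.card ≤ α.card := by
    have h1 : (α.filter fun d => ¬ b < d).card + (α.filter (b < ·)).card = α.card := by
      rw [add_comm]; exact Finset.card_filter_add_card_filter_not _
    have h2 : 1 < (α.filter fun d => ¬ b < d).card :=
      Finset.one_lt_card.2 ⟨e, by simp [he, heb.le], b, by simp [hb], heb.ne⟩
    have h3 := Finset.card_insert_le (1 / 7) (insert (4 / 7) (α.filter (b < ·)))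
    have h4 := Finset.card_insert_le (4 / 7) (α.filter (b < ·))
    change (insert (1 / 7) (insert (4 / 7) (α.filter (b < ·)))).card ≤ _
    omega
  have hne : β.Nonempty := Finset.insert_nonempty _ _
  have h0 := h.2 β hne hcard
  have hcont' := continuous_sqDist hne
  rw [hμ.eq _ hcont, hμ.eq _ hcont', affInt_right hcont, affInt_right hcont'] at h0
  have h1 := hasMoments_P.affInt_le_sq hcont' (r := 0) (s := 1 / 4) (t := 1 / 7) (by norm_num)
    fun y _ _ => sqDist_le (by simp [β]) y
  have h2 := hasMoments_P.affInt_le_sq hcont' (r := 1 / 2) (s := 1 / 8) (t := 4 / 7)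
    (by norm_num) fun y _ _ => sqDist_le (by simp [β]) y
  have h3 := hasMoments_tailMeasure.affInt_mono hcont' hcont (r := 3 / 4) (s := 1 / 4)
    (by norm_num) fun y hy _ => le_sqDist h.1 fun d hd' => by
      rcases le_or_gt d b with h | h
      · have := sqDist_le (show c ∈ β by simp [β, hc]; right; right; linarith) y
        nlinarith
      · exact sqDist_le (by simp [β, hd', h]) y
  have h4 := hasMoments_P.const_le_affInt hcont (r := 0) (s := 1 / 4) (by norm_num)
    fun y _ _ => sqDist_nonneg α y
  have h5 := hasMoments_P.sq_le_affInt hcont (r := 1 / 2) (s := 1 / 8) (t := 1 - b) (by norm_num)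
    fun y hy hy' => sq_le_sqDist_right h.1 hb'
      (fun d hd' => (hd d hd').imp_right fun h => by linarith) hy (by linarith)
  norm_num at h1 h2 h5
  -- With b ≤ 8/25 the gain on [1/2, 5/8] has weight (1 - w)/2 ≥ w/2, and half of 11/1000 exceeds
  -- the full cost 18/3577 of the left part.
  have h6 : (1 / 2 + 1 / 14 - (1 - b)) ^ 2 ≥ 11 / 1000 := by nlinarith
  have h7 : affInt P (sqDist β) (1 / 2) (1 / 8) + 11 / 1000 ≤
    affInt P (sqDist α) (1 / 2) (1 / 8) := by linarith
  nlinarith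

/-- Replacing b by 4/7 gains on [1/2, 5/8]. On the left, mass served by b falls back to e, and the
lower bounds on e and b confine the loss to [7/32, 1/4]. -/
theorem IsOptimalFor.false_of_three_consecutive (hμ : IsMixture μ w) (h : IsOptimalFor μ α)
    {e b c : ℝ} (he : e ∈ α) (he0 : 0 ≤ e) (heb : e < b) (hb : b ∈ α) (hc : c ∈ α)
    (hd : ∀ d ∈ α, d ≤ b ∨ c ≤ d) (hd' : ∀ d ∈ α, d ≤ e ∨ b ≤ d) (hb' : b ≤ 3 / 8)
    (hbc : 1 < b + c) (hc' : c ≤ 1) : False := by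
  have hb0 := h.lt_of_add_gt_one hμ hb hc hd hb' hbc hc' he heb
  have he1 := h.ge_of_consecutive hμ he he0 hd' hb0.le
  have hw := hμ.le
  have hw' := hμ.le_half
  have hcont := continuous_sqDist h.1
  set β : Finset ℝ := insert (4 / 7) (α.erase b)
  have heβ : e ∈ β := Finset.mem_insert_of_mem (Finset.mem_erase.2 ⟨heb.ne, he⟩)
  have hne : β.Nonempty := Finset.insert_nonempty _ _
  have h0 := h.2 β hne (card_insert_erase_le hb _)
  have hcont' := continuous_sqDist hne
  rw [hμ.eq _ hcont, hμ.eq _ hcont', affInt_right hcont, affInt_right hcont', affInt_left₃ hcont,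
    affInt_left₃ hcont'] at h0
  have hleft : ∀ y, 2 * y ≤ e + b → sqDist β y ≤ sqDist α y + 0 := fun y hy =>
    sqDist_insert_erase_le h.1 (fun _ => by nlinarith [sqDist_le heβ y]) le_rfl
  have h1 := hasMoments_P.affInt_le_add_const hcont' hcont (r := 0) (s := 1 / 16) (by norm_num)
    fun y _ hy => hleft y (by linarith)
  have h2 := hasMoments_P.affInt_le_add_const hcont' hcont (r := 1 / 8) (s := 1 / 32)
    (by norm_num) fun y _ hy => hleft y (by linarith)
  have h3 := hasMoments_P.affInt_le_add_const hcont' hcont (r := 3 / 16) (s := 1 / 64)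
    (by norm_num) fun y _ hy => hleft y (by linarith)
  -- The loss is (b - e)(2y - b - e), bounded using y ≤ 1/4 and e ≥ 61/500.
  have h4 := hasMoments_tailMeasure.affInt_le_add_const hcont' hcont (r := 7 / 32) (s := 1 / 32)
    (C := (b - 61 / 500) * (189 / 500 - b)) (by norm_num) fun y _ hy =>
      sqDist_insert_erase_le h.1 (fun _ => by
        have h5 := sqDist_le heβ y
        have h6 : (b - e) * (2 * y - b - e) ≤ (b - 61 / 500) * (189 / 500 - b) := by
          rcases le_or_gt (2 * y - b - e) 0 with h | h
          · exact (mul_nonpos_of_nonneg_of_nonpos (by linarith) h).trans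
              (mul_nonneg (by linarith) (by linarith))
          · exact mul_le_mul (by linarith) (by linarith) h.le (by linarith)
        nlinarith) (mul_nonneg (by linarith) (by linarith))
  have h5 := hasMoments_P.affInt_le_sq hcont' (r := 1 / 2) (s := 1 / 8) (t := 4 / 7)
    (by norm_num) fun y _ _ => sqDist_le (by simp [β]) y
  have h6 := hasMoments_P.sq_le_affInt hcont (r := 1 / 2) (s := 1 / 8) (t := 1 - b) (by norm_num)
    fun y hy hy' => sq_le_sqDist_right h.1 hb'
      (fun d hd' => (hd d hd').imp_right fun h => by linarith) hy (by linarith)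
  have h7 := hasMoments_tailMeasure.affInt_le_add_const hcont' hcont (r := 3 / 4) (s := 1 / 4)
    (by norm_num) fun y hy _ => sqDist_insert_erase_le_of_le (y := 4 / 7) h.1
      (by linarith : b < c) hc (by linarith)
  norm_num at h5 h6
  have h8 : 3 / 16 * ((b - 61 / 500) * (189 / 500 - b)) < 1 / 2 * (4 / 7 - (1 - b)) ^ 2 := by
    nlinarith
  have h10 : w * (3 / 16 * ((b - 61 / 500) * (189 / 500 - b))) <
      w * (1 / 2 * (4 / 7 - (1 - b)) ^ 2) := by gcongr
  have h11 : w * (1 / 2 * (4 / 7 - (1 - b)) ^ 2) ≤ (1 - w) * (1 / 2 * (4 / 7 - (1 - b)) ^ 2) := by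
    gcongr; linarith
  have h12 := mul_le_mul_of_nonneg_left h1 (by linarith : 0 ≤ w)
  have h13 := mul_le_mul_of_nonneg_left h2 (by linarith : 0 ≤ w)
  have h14 := mul_le_mul_of_nonneg_left h3 (by linarith : 0 ≤ w)
  have h15 := mul_le_mul_of_nonneg_left h4 (by linarith : 0 ≤ w)
  have h16 := mul_le_mul_of_nonneg_left (h5.trans (by linarith :
    _ ≤ affInt P (sqDist α) (1 / 2) (1 / 8) - (4 / 7 - (1 - b)) ^ 2)) (by linarith : 0 ≤ 1 - w)
  have h17 := mul_le_mul_of_nonneg_left h7 (by linarith : 0 ≤ 1 - w)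
  linarith

/-! ### Optimal sets of two points -/

theorem sq_le_sq_dist_pair {c t y m l r : ℝ} (hm : 0 ≤ m) (h1 : m ≤ l - c) (h2 : m ≤ t - r)
    (hl : l ≤ y) (hr : y ≤ r) : m ^ 2 ≤ sqDist {c, t} y := by
  refine le_sqDist (by simp) fun d hd => ?_
  simp only [Finset.mem_insert, Finset.mem_singleton] at hd
  rcases hd with rfl | rfl <;> nlinarith

theorem le_affInt_pair {c t m₁ m₂ m₃ : ℝ} (h₁ : 0 ≤ m₁) (h₂ : 0 ≤ m₂) (h₃ : 0 ≤ m₃)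
    (h1 : m₁ ≤ 1 / 2 - c) (h1' : m₁ ≤ t - 17 / 32) (h2 : m₂ ≤ 9 / 16 - c) (h2' : m₂ ≤ t - 37 / 64)
    (h3 : m₃ ≤ 19 / 32 - c) (h3' : m₃ ≤ t - 5 / 8) :
    1 / 4 * m₁ ^ 2 + 3 / 8 * m₂ ^ 2 + 3 / 8 * m₃ ^ 2 ≤
      affInt P (sqDist {c, t}) (1 / 2) (1 / 8) := by
  have hcont := continuous_sqDist (α := {c, t}) (by simp)
  rw [affInt_right_left hcont]
  have e1 := hasMoments_P.const_le_affInt hcont (r := 1 / 2) (s := 1 / 32) (by norm_num)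
    fun y hy hy' => sq_le_sq_dist_pair h₁ h1 h1' hy (by linarith)
  have e2 := hasMoments_P.const_le_affInt hcont (r := 9 / 16) (s := 1 / 64) (by norm_num)
    fun y hy hy' => sq_le_sq_dist_pair h₂ h2 h2' hy (by linarith)
  have e3 := hasMoments_tailMeasure.const_le_affInt hcont (r := 19 / 32) (s := 1 / 32)
    (by norm_num) fun y hy hy' => sq_le_sq_dist_pair h₃ h3 h3' hy (by linarith)
  linarith

/-- J stands for the energy on [1/2, 5/8], and 301/14308 is 86/3577 less half the variance on [3/4,
1]. The parenthesis is thus the most a bad pair can save on the right part compared with the pair of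
means; 3 is the largest value of (1 - w)/w. The proof tabulates c and t. -/
theorem gap_of_pair_energy {c t J : ℝ} (hc : c < 103 / 250) (ht : t ≤ 1)
    (hJ0 : 0 ≤ J) (hsmall : c ≤ 6 / 25 → 9 / 7154 + (3 / 7 - c) ^ 2 ≤ J)
    (hct : c ≤ 3 / 8 → 1 - c < t)
    (hJ : ∀ m₁ m₂ m₃, 0 ≤ m₁ → 0 ≤ m₂ → 0 ≤ m₃ → m₁ ≤ 1 / 2 - c → m₁ ≤ t - 17 / 32 →
      m₂ ≤ 9 / 16 - c → m₂ ≤ t - 37 / 64 → m₃ ≤ 19 / 32 - c → m₃ ≤ t - 5 / 8 →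
      1 / 4 * m₁ ^ 2 + 3 / 8 * m₂ ^ 2 + 3 / 8 * m₃ ^ 2 ≤ J) :
    3 * (301 / 14308 - 1 / 2 * J - 1 / 2 * (t - 6 / 7) ^ 2) < (c - 1 / 7) ^ 2 := by
  rcases le_or_gt c (6 / 25) with h1 | h1
  · have := hsmall h1
    nlinarith [sq_nonneg (t - 6 / 7)]
  rcases le_or_gt c (27 / 100) with h2 | h2
  · have h3 := hct (by linarith)
    have h4 : (6 / 25 - 1 / 7) ^ 2 ≤ (c - 1 / 7) ^ 2 := by gcongr
    rcases le_or_gt t (87 / 100) with h5 | h5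
    · have := hJ (99 / 500) (t - 37 / 64) (t - 5 / 8) (by norm_num) (by linarith) (by linarith)
        (by linarith) (by linarith) (by linarith) (by linarith) (by linarith) (by linarith)
      -- 299/400 is close to the minimizer in t of the quadratic formed by the bounds on J and the
      -- term (t - 6/7)².
      nlinarith [sq_nonneg (t - 299 / 400)]
    · have := hJ (23 / 100) (29 / 100) (24 / 100) (by norm_num) (by norm_num) (by norm_num)
        (by linarith) (by linarith) (by linarith) (by linarith) (by linarith) (by linarith)
      nlinarith [sq_nonneg (t - 6 / 7)]
  rcases le_or_gt c (3 / 10) with h2' | h2'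
  · have h3 := hct (by linarith)
    have h4 : (27 / 100 - 1 / 7) ^ 2 ≤ (c - 1 / 7) ^ 2 := by gcongr
    rcases le_or_gt t (84 / 100) with h5 | h5
    · have := hJ (84 / 500) (t - 37 / 64) (t - 5 / 8) (by norm_num) (by linarith) (by linarith)
        (by linarith) (by linarith) (by linarith) (by linarith) (by linarith) (by linarith)
      nlinarith [sq_nonneg (t - 299 / 400)]
    · have := hJ (20 / 100) (26 / 100) (21 / 100) (by norm_num) (by norm_num) (by norm_num)
        (by linarith) (by linarith) (by linarith) (by linarith) (by linarith) (by linarith)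
      nlinarith [sq_nonneg (t - 6 / 7)]
  rcases le_or_gt c (35 / 100) with h2'' | h2''
  · have h3 := hct (by linarith)
    have h4 : (3 / 10 - 1 / 7) ^ 2 ≤ (c - 1 / 7) ^ 2 := by gcongr
    rcases le_or_gt t (79 / 100) with h5 | h5
    · have := hJ 0 (t - 37 / 64) (t - 5 / 8) (by norm_num) (by linarith) (by linarith)
        (by linarith) (by linarith) (by linarith) (by linarith) (by linarith) (by linarith)
      nlinarith [sq_nonneg (t - 299 / 400)]
    · have := hJ (15 / 100) (21 / 100) (16 / 100) (by norm_num) (by norm_num) (by norm_num)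
        (by linarith) (by linarith) (by linarith) (by linarith) (by linarith) (by linarith)
      nlinarith [sq_nonneg (t - 6 / 7)]
  rcases le_or_gt t (73 / 100) with h5 | h5
  · have h4 : (35 / 100 - 1 / 7) ^ 2 ≤ (c - 1 / 7) ^ 2 := by gcongr
    nlinarith
  rcases le_or_gt c (38 / 100) with h2 | h2
  · have h4 : (35 / 100 - 1 / 7) ^ 2 ≤ (c - 1 / 7) ^ 2 := by gcongr
    have := hJ (12 / 100) (15 / 100) (10 / 100) (by norm_num) (by norm_num) (by norm_num)
      (by linarith) (by linarith) (by linarith) (by linarith) (by linarith) (by linarith)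
    nlinarith [sq_nonneg (t - 6 / 7)]
  · have h4 : (38 / 100 - 1 / 7) ^ 2 ≤ (c - 1 / 7) ^ 2 := by gcongr
    have := hJ (8 / 100) (15 / 100) (10 / 100) (by norm_num) (by norm_num) (by norm_num)
      (by linarith) (by linarith) (by linarith) (by linarith) (by linarith) (by linarith)
    nlinarith [sq_nonneg (t - 6 / 7)]

/-- Against the pair of means, the left part loses (c - 1/7)², which must be paid for by a saving on
the right; `gap_of_pair_energy` shows that the saving is too small. -/
theorem IsOptimalFor.pair_false (hμ : IsMixture μ w) {c t : ℝ} (h : IsOptimalFor μ {c, t})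
    (hc0 : 0 ≤ c) (hct : c < t) (ht : t ≤ 1) (hbad : c ≤ 3 / 8 → 1 - c < t) : False := by
  have hw := hμ.le
  have hw' := hμ.le_half
  have hcont := continuous_sqDist h.1
  have h0 := h.le_of_two_le_card hμ (Finset.card_pair hct.ne).ge
  rw [hμ.eq _ hcont] at h0
  have h1 := hasMoments_P.sq_le_affInt hcont (r := 0) (s := 1 / 4) (t := c) (by norm_num)
    fun y _ hy => le_sqDist h.1 fun d hd => by
      simp only [Finset.mem_insert, Finset.mem_singleton] at hd
      rcases hd with rfl | rfl
      · rfl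
      · rcases le_or_gt c (3 / 8) with h | h
        · nlinarith [hbad h]
        · nlinarith
  norm_num at h1
  have h2 : w * (18 / 3577 + (1 / 7 - c) ^ 2) ≤ w * affInt P (sqDist {c, t}) 0 (1 / 4) := by gcongr
  have h3 : 1 / 4 * (1 / 7 - c) ^ 2 ≤ w * (1 / 7 - c) ^ 2 := by gcongr
  have h4 : (1 - w) * (affInt tailMeasure (sqDist {c, t}) (1 / 2) (1 / 2) - 86 / 3577) ≤
    -(1 / 4 * (1 / 7 - c) ^ 2) := by linarith
  have h5 : (1 / 7 - c) ^ 2 ≤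
      3 * (86 / 3577 - affInt tailMeasure (sqDist {c, t}) (1 / 2) (1 / 2)) := by
    nlinarith [sq_nonneg (1 / 7 - c)]
  -- From 103/250 on, (c - 1/7)² exceeds 3 · 86/3577, so even zero energy on the right would not
  -- suffice.
  rcases le_or_gt (103 / 250) c with h6 | h6
  · have h7 := hasMoments_tailMeasure.const_le_affInt hcont (r := 1 / 2) (s := 1 / 2)
      (by norm_num) fun y _ _ => sqDist_nonneg {c, t} y
    nlinarith
  · rw [affInt_right hcont] at h5
    have h7 := hasMoments_tailMeasure.sq_le_affInt hcont (r := 3 / 4) (s := 1 / 4) (t := t)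
      (by norm_num) fun y hy _ => le_sqDist h.1 fun d hd => by
        simp only [Finset.mem_insert, Finset.mem_singleton] at hd
        rcases hd with rfl | rfl
        · nlinarith
        · rfl
    have h8 := gap_of_pair_energy h6 ht (hasMoments_P.const_le_affInt hcont (r := 1 / 2)
      (s := 1 / 8) (by norm_num) fun y _ _ => sqDist_nonneg {c, t} y) (fun h9 => by
        have := hasMoments_P.sq_le_affInt hcont (r := 1 / 2) (s := 1 / 8) (t := 1 - c)
          (by norm_num) fun y hy hy' => sq_le_sqDist_right h.1 (by linarith) (fun d hd => by
            simp only [Finset.mem_insert, Finset.mem_singleton] at hd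
            rcases hd with rfl | rfl
            · exact Or.inl le_rfl
            · exact Or.inr (hbad (by linarith))) hy (by linarith)
        norm_num at this
        nlinarith) hbad
      (fun m₁ m₂ m₃ => le_affInt_pair)
    norm_num at h7
    nlinarith

end

/-! ### Optimal sets split into optimal sets of the two parts -/

section

variable {μ : Measure ℝ} {w : ℝ} {α : Finset ℝ}

theorem IsOptimalFor.exists_split (hμ : IsMixture μ w) (h : IsOptimalFor μ α)
    (hα : ∀ c ∈ α, 0 ≤ c ∧ c ≤ 1) (hcard : 2 ≤ α.card) :
    ∃ b ∈ α, ∃ c ∈ α, b ≤ 3 / 8 ∧ 3 / 8 < c ∧ (∀ d ∈ α, d ≤ b ∨ c ≤ d) ∧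
      1 / 2 ≤ b + c ∧ b + c ≤ 1 := by
  have hpair : ∀ x ∈ α, ∀ y ∈ α, x < y → (x ≤ 3 / 8 → 1 - x < y) → ¬ α.card ≤ 2 := by
    intro x hx y hy hxy hbad hle
    have he : {x, y} = α := Finset.eq_of_subset_of_card_le
      (by simp [Finset.insert_subset_iff, hx, hy]) (by rwa [Finset.card_pair hxy.ne])
    rw [← he] at h
    exact h.pair_false hμ (hα x hx).1 hxy (hα y hy).2 hbad
  obtain ⟨c₀, hc₀, hc₀'⟩ := h.exists_gt hμ hcard
  have hR : (α.filter (3 / 8 < ·)).Nonempty := ⟨c₀, by simp [hc₀, hc₀']⟩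
  have hL : (α.filter (· ≤ 3 / 8)).Nonempty := by
    by_contra hL
    rw [Finset.not_nonempty_iff_eq_empty, Finset.filter_eq_empty_iff] at hL
    simp only [not_le] at hL
    rcases le_or_gt 3 α.card with h3 | h3
    · exact h.false_of_forall_gt hμ h3 hL
    · obtain ⟨x, hx, y, hy, hxy⟩ := Finset.one_lt_card.1 hcard
      rcases lt_or_gt_of_ne hxy with hlt | hlt
      · exact hpair x hx y hy hlt (fun h' => absurd (hL hx) h'.not_gt) (by omega)
      · exact hpair y hy x hx hlt (fun h' => absurd (hL hy) h'.not_gt) (by omega)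
  obtain ⟨b, hb, hbmax⟩ := Finset.exists_max_image _ id hL
  obtain ⟨c, hc, hcmin⟩ := Finset.exists_min_image _ id hR
  simp only [Finset.mem_filter, id] at hb hbmax hc hcmin
  have hd : ∀ d ∈ α, d ≤ b ∨ c ≤ d := fun d hd =>
    (le_or_gt d (3 / 8)).imp (fun h => hbmax d ⟨hd, h⟩) fun h => hcmin d ⟨hd, h⟩
  refine ⟨b, hb.1, c, hc.1, hb.2, hc.2, hd,
    h.half_le_add hμ hb.1 (hα b hb.1).1 hd hc.2.le, ?_⟩
  by_contra! hlt
  by_cases hE : (α.filter (· < b)).Nonempty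
  · obtain ⟨e, he, hemax⟩ := Finset.exists_max_image _ id hE
    simp only [Finset.mem_filter, id] at he hemax
    exact h.false_of_three_consecutive hμ he.1 (hα e he.1).1 he.2 hb.1 hc.1 hd
      (fun d hd => (lt_or_ge d b).imp_left fun h => hemax d ⟨hd, h⟩) hb.2 hlt (hα c hc.1).2
  · rw [Finset.not_nonempty_iff_eq_empty, Finset.filter_eq_empty_iff] at hE
    rcases le_or_gt 3 α.card with h3 | h3
    · refine h.false_of_left_singleton hμ h3 hb.2 fun d hd' => ?_
      rcases hd d hd' with h | h
      · exact Or.inl (le_antisymm h (not_lt.1 (hE hd')))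
      · exact Or.inr (by linarith)
    · exact hpair b hb.1 c hc.1 (by linarith) (fun _ => by linarith) (by omega)

theorem sqDist_image_affine {α : Finset ℝ} (hα : α.Nonempty) (r s x : ℝ) :
    sqDist (α.image fun y => r + s * y) (r + s * x) = s ^ 2 * sqDist α x := by
  apply le_antisymm
  · obtain ⟨c, hc, e⟩ := exists_sqDist_eq hα x
    rw [e]
    exact (sqDist_le (Finset.mem_image_of_mem _ hc) _).trans_eq (by ring)
  · refine le_sqDist (hα.image _) fun d hd => ?_
    obtain ⟨c, hc, rfl⟩ := Finset.mem_image.1 hd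
    nlinarith [sqDist_le hc x, sq_nonneg s]

theorem affInt_sqDist_image (ν : Measure ℝ) {α : Finset ℝ} (hα : α.Nonempty) (r s : ℝ) :
    affInt ν (sqDist (α.image fun y => r + s * y)) r s = s ^ 2 * ∫ x, sqDist α x ∂ν := by
  simp only [affInt, sqDist_image_affine hα, integral_const_mul]

/-- Competitors for one part are tested by transporting them into its interval and keeping the other
part of α fixed. -/
theorem IsOptimalFor.image_part {ν : Measure ℝ} {A B : Finset ℝ} {r s : ℝ}
    (h : IsOptimalFor μ α) (hs : 0 < s) (hA : A.Nonempty) (hcard : A.card + B.card = α.card)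
    (hcmp : ∀ β : Finset ℝ, β.Nonempty → ∫ x, sqDist α x ∂μ ≤ ∫ x, sqDist (β ∪ B) x ∂μ →
      affInt ν (sqDist A) r s ≤ affInt ν (sqDist β) r s) :
    IsOptimalFor ν (A.image fun y => (y - r) / s) := by
  refine ⟨hA.image _, fun β hβ hle => ?_⟩
  have h1 : (A.image fun y => (y - r) / s).image (fun y => r + s * y) = A := by
    have hid : (fun y => r + s * y) ∘ (fun y => (y - r) / s) = id := by
      ext y
      simp only [Function.comp, id]
      field_simp
      ring
    rw [Finset.image_image, hid, Finset.image_id]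
  have h2 := hcmp (β.image fun y => r + s * y) (hβ.image _) (h.2 _
    ((hβ.image _).mono Finset.subset_union_left) ?_)
  · conv_lhs at h2 => rw [← h1]
    rw [affInt_sqDist_image ν (hA.image _), affInt_sqDist_image ν hβ] at h2
    exact le_of_mul_le_mul_left h2 (by positivity)
  · have h3 := Finset.card_union_le (β.image fun y => r + s * y) B
    have h4 := Finset.card_image_le (s := β) (f := fun y => r + s * y)
    have h5 := Finset.card_image_le (s := A) (f := fun y => (y - r) / s)
    omega

/-- With the midpoint in [1/4, 1/2], the left interval is served by A alone and the right one by B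
alone, so improving one part would improve the whole. -/
theorem IsOptimalFor.image_parts (hμ : IsMixture μ w) (h : IsOptimalFor μ α) {b c : ℝ}
    (hb : b ∈ α) (hc : c ∈ α) (hb' : b ≤ 3 / 8) (hc' : 3 / 8 < c)
    (hd : ∀ d ∈ α, d ≤ b ∨ c ≤ d) (h1 : 1 / 2 ≤ b + c) (h2 : b + c ≤ 1) :
    IsOptimalFor P ((α.filter (· ≤ 3 / 8)).image fun y => (y - 0) / (1 / 4)) ∧
      IsOptimalFor tailMeasure
        ((α.filter fun d => ¬ d ≤ 3 / 8).image fun y => (y - 1 / 2) / (1 / 2)) := by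
  have hw := hμ.le
  have hw' := hμ.le_half
  set A := α.filter (· ≤ 3 / 8)
  set B := α.filter fun d => ¬ d ≤ 3 / 8
  have hbA : b ∈ A := by simp [A, hb, hb']
  have hcB : c ∈ B := by simp [B, hc, hc']
  have hA : A.Nonempty := ⟨b, hbA⟩
  have hB : B.Nonempty := ⟨c, hcB⟩
  have hcard : A.card + B.card = α.card := Finset.card_filter_add_card_filter_not _
  have hcont := continuous_sqDist h.1
  have hleft := hasMoments_P.affInt_mono (continuous_sqDist hA) hcont (r := 0) (s := 1 / 4)
    (by norm_num) fun y _ hy => le_sqDist h.1 fun d hd' => by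
      by_cases hd8 : d ≤ 3 / 8
      · exact sqDist_le (by simp [A, hd', hd8]) y
      · refine (sqDist_le hbA y).trans ?_
        rcases hd d hd' with h | h
        · linarith
        · nlinarith
  have hright := hasMoments_tailMeasure.affInt_mono (continuous_sqDist hB) hcont (r := 1 / 2)
    (s := 1 / 2) (by norm_num) fun y hy _ => le_sqDist h.1 fun d hd' => by
      by_cases hd8 : d ≤ 3 / 8
      · refine (sqDist_le hcB y).trans ?_
        rcases hd d hd' with h | h
        · nlinarith
        · linarith
      · exact sqDist_le (by simpa [B, hd'] using hd8) y
  have hunion : ∀ β γ : Finset ℝ, β.Nonempty → γ.Nonempty →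
      affInt P (sqDist (β ∪ γ)) 0 (1 / 4) ≤ affInt P (sqDist β) 0 (1 / 4) ∧
      affInt tailMeasure (sqDist (β ∪ γ)) (1 / 2) (1 / 2) ≤
        affInt tailMeasure (sqDist γ) (1 / 2) (1 / 2) := fun β γ hβ hγ =>
    have hcont' := continuous_sqDist (hβ.mono (Finset.subset_union_left (s₂ := γ)))
    ⟨hasMoments_P.affInt_mono hcont' (continuous_sqDist hβ) (by norm_num)
      fun y _ _ => sqDist_anti hβ Finset.subset_union_left y,
    hasMoments_tailMeasure.affInt_mono hcont' (continuous_sqDist hγ) (by norm_num)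
      fun y _ _ => sqDist_anti hγ Finset.subset_union_right y⟩
  constructor
  · refine h.image_part (B := B) (by norm_num) hA hcard fun β hβ hle => ?_
    obtain ⟨h3, h4⟩ := hunion β B hβ hB
    rw [hμ.eq _ hcont, hμ.eq _ (continuous_sqDist (hβ.mono Finset.subset_union_left))] at hle
    nlinarith
  · refine h.image_part (B := A) (by norm_num) hB (by omega) fun β hβ hle => ?_
    obtain ⟨h3, h4⟩ := hunion A β hA hβ
    rw [Finset.union_comm, hμ.eq _ hcont,
      hμ.eq _ (continuous_sqDist (hA.mono Finset.subset_union_left))] at hle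
    nlinarith

/-! ### The points of an optimal set -/

theorem HasMoments.eq_mean_of_isOptimalFor_singleton {m v c : ℝ} (hm : HasMoments μ m v)
    (h : IsOptimalFor μ {c}) : c = m := by
  have h0 := h.2 {m} (by simp) (by simp)
  have h1 := hm.sq_le_affInt (continuous_sqDist h.1) (r := 0) (s := 1) (t := c) zero_le_one
    fun y _ _ => le_sqDist h.1 fun d hd => by rw [Finset.mem_singleton.1 hd]
  have h2 := hm.affInt_le_sq (continuous_sqDist (α := {m}) (by simp)) (r := 0) (s := 1) (t := m)
    zero_le_one fun y _ _ => sqDist_le (by simp) y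
  simp only [affInt, zero_add, one_mul] at h1 h2
  nlinarith [sq_nonneg (m - c)]

/-- The projection of `ℝ` onto `[0, 1]`. -/
noncomputable def clamp (x : ℝ) : ℝ := max 0 (min x 1)

theorem sq_sub_clamp_le {x c : ℝ} (h0 : 0 ≤ x) (h1 : x ≤ 1) : (x - clamp c) ^ 2 ≤ (x - c) ^ 2 := by
  rcases le_total c 0 with h | h
  · rw [clamp, min_eq_left (by linarith), max_eq_left h]; nlinarith
  rcases le_total c 1 with h' | h'
  · rw [clamp, min_eq_left h', max_eq_right h]
  · rw [clamp, min_eq_right h', max_eq_right zero_le_one]; nlinarith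

theorem clamp_eq_self {c : ℝ} (h0 : 0 < clamp c) (h1 : clamp c < 1) : clamp c = c := by
  rw [clamp] at *
  rcases le_total c 1 with h | h
  · rw [min_eq_left h] at *
    exact max_eq_right (by by_contra! h'; rw [max_eq_left h'.le] at h0; exact h0.false)
  · rw [min_eq_right h] at h1
    exact absurd h1 (by simp)

/-- Projection onto the support brings points closer to it. It may merge points, which does no harm
because fewer points face fewer competitors. -/
theorem IsOptimalFor.image_clamp {m v : ℝ} (hm : HasMoments μ m v) (h : IsOptimalFor μ α) :
    IsOptimalFor μ (α.image clamp) := by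
  refine ⟨h.1.image _, fun β hβ hle => le_trans ?_ (h.2 β hβ (hle.trans Finset.card_image_le))⟩
  refine hm.integral_mono (continuous_sqDist (h.1.image _)) (continuous_sqDist h.1)
    fun x h0 h1 => le_sqDist h.1 fun c hc => ?_
  exact (sqDist_le (Finset.mem_image_of_mem clamp hc) x).trans (sq_sub_clamp_le h0 h1)

/-- The induction step common to both measures, for a property M of points. -/
theorem IsOptimalFor.forall_mem {m v : ℝ} (hμ : IsMixture μ w) (hm : HasMoments μ m v)
    {M : ℝ → Prop} (hM : ∀ x, M x → 0 < x ∧ x < 1) (hMm : M m)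
    (hP : ∀ β : Finset ℝ, β.card < α.card → IsOptimalFor P β → ∀ y ∈ β, M (y / 4))
    (hQ : ∀ β : Finset ℝ, β.card < α.card → IsOptimalFor tailMeasure β →
      ∀ y ∈ β, M ((y + 1) / 2))
    (h : IsOptimalFor μ α) : ∀ c ∈ α, M c := by
  -- M forces the clamped points into the open interval (0, 1), so clamping moved nothing.
  suffices hs : ∀ c ∈ α.image clamp, M c by
    intro c hc
    have h1 := hs _ (Finset.mem_image_of_mem clamp hc)
    rwa [clamp_eq_self (hM _ h1).1 (hM _ h1).2] at h1
  have h' := h.image_clamp hm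
  have hle : (α.image clamp).card ≤ α.card := Finset.card_image_le
  rcases le_or_gt (α.image clamp).card 1 with h1 | h1
  · obtain ⟨c, hc⟩ := Finset.card_eq_one.1 (le_antisymm h1 (Finset.card_pos.2 h'.1))
    rw [hc] at h' ⊢
    intro d hd
    rw [Finset.mem_singleton.1 hd, hm.eq_mean_of_isOptimalFor_singleton h']
    exact hMm
  · obtain ⟨b, hb, c, hc, hb', hc', hd, h2, h3⟩ := h'.exists_split hμ (fun d hd => by
      obtain ⟨x, -, rfl⟩ := Finset.mem_image.1 hd
      exact ⟨le_max_left _ _, max_le zero_le_one (min_le_right _ _)⟩) h1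
    obtain ⟨h4, h5⟩ := h'.image_parts hμ hb hc hb' hc' hd h2 h3
    set γ := α.image clamp
    have hA : (γ.filter (· ≤ 3 / 8)).card < γ.card :=
      Finset.card_lt_card (Finset.filter_ssubset.2 ⟨c, hc, hc'.not_ge⟩)
    have hB : (γ.filter fun d => ¬ d ≤ 3 / 8).card < γ.card :=
      Finset.card_lt_card (Finset.filter_ssubset.2 ⟨b, hb, not_not.2 hb'⟩)
    intro d hd
    by_cases h8 : d ≤ 3 / 8
    · have := hP _ (Finset.card_image_le.trans_lt (hA.trans_le hle)) h4 ((d - 0) / (1 / 4))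
        (Finset.mem_image_of_mem _ (by simp [hd, h8]))
      rwa [show (d - 0) / (1 / 4) / 4 = d by ring] at this
    · have := hQ _ (Finset.card_image_le.trans_lt (hB.trans_le hle)) h5 ((d - 1 / 2) / (1 / 2))
        (Finset.mem_image_of_mem _ (by simpa [hd] using h8))
      rwa [show ((d - 1 / 2) / (1 / 2) + 1) / 2 = d by ring] at this

end

/-- `x` is the image of the mean of `P`, or of a rescaled tail of `P`, under some `S_ω`. -/
def IsCylinderMean (x : ℝ) : Prop :=
  ∃ ω : List ℕ+, x = wordMap ω (4 / 7) ∨ ∃ k : ℕ+, x = wordMap ω (tailMap k (3 / 7))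

theorem IsCylinderMean.apply_S {x : ℝ} (h : IsCylinderMean x) (j : ℕ+) :
    IsCylinderMean (S j x) := by
  obtain ⟨ω, rfl | ⟨k, rfl⟩⟩ := h
  · exact ⟨j :: ω, Or.inl rfl⟩
  · exact ⟨j :: ω, Or.inr ⟨k, rfl⟩⟩

theorem wordMap_mem_Ioo (ω : List ℕ+) {x : ℝ} (h0 : 0 < x) (h1 : x < 1) :
    0 < wordMap ω x ∧ wordMap ω x < 1 := by
  obtain ⟨s, r, hs, h⟩ := wordMap_affine ω
  have e0 := wordMap_mem_Icc ω (x := 0) (by simp)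
  have e1 := wordMap_mem_Icc ω (x := 1) (by simp)
  rw [h, Set.mem_Icc] at e0 e1
  rw [h]
  constructor <;> nlinarith

theorem IsCylinderMean.pos_and_lt_one {x : ℝ} (h : IsCylinderMean x) : 0 < x ∧ x < 1 := by
  obtain ⟨ω, rfl | ⟨k, rfl⟩⟩ := h
  · exact wordMap_mem_Ioo ω (by norm_num) (by norm_num)
  · have := half_pow_pos (k : ℕ)
    have := half_pow_pnat_le k
    apply wordMap_mem_Ioo <;> rw [tailMap] <;> linarith

/-- For `tailMeasure` the claim must hold under every `tailMap k`, because it meets P only through a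
tail: `tailMap k` turns S_j into S_{k+j} and composes with `tailMap 1` to `tailMap (k + 1)`.
Positivity of c is carried along because the tail images alone do not give it. -/
theorem IsOptimalFor.isCylinderMean (n : ℕ) : ∀ α : Finset ℝ, α.card = n →
    (IsOptimalFor P α → ∀ c ∈ α, IsCylinderMean c) ∧
    (IsOptimalFor tailMeasure α →
      ∀ c ∈ α, 0 < c ∧ ∀ k : ℕ+, IsCylinderMean (tailMap k c)) := by
  induction n using Nat.strong_induction_on with
  | _ n ih =>
    rintro α rfl
    have hS : ∀ y, IsCylinderMean y → IsCylinderMean (y / 4) := fun y hy => by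
      have := hy.apply_S 1
      rwa [S_one] at this
    constructor
    · refine IsOptimalFor.forall_mem isMixture_P hasMoments_P (fun x hx => hx.pos_and_lt_one)
        ⟨[], Or.inl rfl⟩ (fun β hβ h y hy => hS y ((ih _ hβ β rfl).1 h y hy))
        fun β hβ h y hy => ?_
      have := ((ih _ hβ β rfl).2 h y hy).2 1
      rwa [PNat.one_coe, tailMap_one] at this
    · refine IsOptimalFor.forall_mem isMixture_tailMeasure hasMoments_tailMeasure
        (fun x hx => ⟨hx.1, ?_⟩) ⟨by norm_num, fun k => ⟨[], Or.inr ⟨k, rfl⟩⟩⟩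
        (fun β hβ h y hy => ?_) fun β hβ h y hy => ?_
      · have := (hx.2 1).pos_and_lt_one.2
        rw [PNat.one_coe, tailMap_one] at this
        linarith
      · have hy' := (ih _ hβ β rfl).1 h y hy
        refine ⟨by linarith [hy'.pos_and_lt_one.1], fun k => ?_⟩
        rw [← S_one, tailMap_S]
        exact hy'.apply_S _
      · obtain ⟨h0, h1⟩ := (ih _ hβ β rfl).2 h y hy
        refine ⟨by linarith, fun k => ?_⟩
        have := h1 (k + 1)
        rw [PNat.add_coe, PNat.one_coe] at this
        convert this using 1
        simp only [tailMap, pow_succ]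
        ring

end NMeans

theorem proposition50 (n : ℕ) (hn : 2 ≤ n) (α : Finset ℝ) (hα : NMeans.IsOptimal n α)
    (c : ℝ) (hc : c ∈ α) :
    (∃ ω : List ℕ+, c = NMeans.a ω ∧ NMeans.a ω = NMeans.wordMap ω (4 / 7)) ∨
      (∃ (ω : List ℕ+) (hω : ω ≠ []), c = NMeans.aInf ω hω) := by
  have hmean := NMeans.mean_P_and_mean_tailMeasure
  obtain ⟨ω, rfl | ⟨k, rfl⟩⟩ :=
    (NMeans.IsOptimalFor.isCylinderMean _ α rfl).1 hα.isOptimalFor c hc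
  · refine Or.inl ⟨ω, ?_, ?_⟩ <;> rw [NMeans.a_eq_wordMap, hmean.1]
  · refine Or.inr ⟨ω ++ [k], by simp, ?_⟩
    rw [NMeans.aInf_append_singleton, hmean.2]
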